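/- There is a randomized algorithm with the following properties. It is given two finite simple graphs $H$ and $G$ (by their adjacency matrices), where $G$ is a forest (in particular, both $H$ and $G$ may be forests), and it decides Subgraph Isomorphism, that is, whether there is an injective map $\eta\colon V(H)\to V(G)$ such that $\eta(u)\eta(v)\in E(G)$ whenever $uv\in E(H)$. Let $k=\mathbf{cc}(H)$ be the number of connected components of $H$ and let $n=\max(2,|V(H)|+|V(G)|)$. For every outcome of its coin tosses the algorithm halts with an answer YES or NO within time $$2^{O(k\log k)}\cdot n^{O(1)},$$ that is, within $c\cdot 2^{c\,k\log_2 k}\cdot n^{c}$ steps for an absolute constant $c$ (where $k\log_2 k=0$ for $k=0$); in particular the time is $f(\mathbf{cc}(H))\cdot n^{O(1)}$ for a computable function $f$. The algorithm has only false negatives: if there is no such map $\eta$, it always answers NO; if there is one, it answers NO with probability at most $\tfrac12$. -/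

import Mathlib

/-! ### The machine model

Programs of a small LISP-like language without recursion (composition, construction of pairs,
conditionals, while loops), acting on binary trees, with an instruction that tosses a fair coin.
Data are never copied or compared as a whole: every instruction only follows, creates or tests one
pointer, so a computation with `t` steps is carried out by a random access machine in time `O(t)`
on words of `O(log t)` bits.  Conversely a random access machine or a Turing machine is simulated
with polynomial overhead. -/

/-- The data: binary trees (`LISP` S-expressions over the single atom `nil`). -/
inductive Data : Type
  | nil : Data
  | cons : Data → Data → Data

namespace Data

/-- First component; `nil` on the atom. -/
def fst : Data → Data
  | nil => nil
  | cons a _ => a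

/-- Second component; `nil` on the atom. -/
def snd : Data → Data
  | nil => nil
  | cons _ b => b

/-- The two answers / truth values: `nil` is NO and `(nil . nil)` is YES. -/
def ofBool : Bool → Data
  | false => nil
  | true => cons nil nil

/-- A list as nested pairs `(a₁ . (a₂ . ( … . nil)))`. -/
def ofList : List Data → Data
  | [] => nil
  | a :: l => cons a (ofList l)

end Data

/-- Programs; each denotes a (partial, randomized) map from data to data. -/
inductive Prog : Type
  /-- return the input -/
  | id : Prog
  /-- return the atom -/
  | nil : Prog
  /-- return the first component of the input -/
  | fst : Prog
  /-- return the second component of the input -/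
  | snd : Prog
  /-- toss a fair coin and return the outcome -/
  | flip : Prog
  /-- run `p` and `q` on the input and pair the results -/
  | pair (p q : Prog) : Prog
  /-- run `p` on the input, then `q` on the result -/
  | seq (p q : Prog) : Prog
  /-- if `b` returns something other than `nil` on the input, run `p` on the input, otherwise `q` -/
  | ite (b p q : Prog) : Prog
  /-- while `b` returns something other than `nil` on the current value, replace that value by the
  result of `p` on it -/
  | loop (b p : Prog) : Prog

/-- `Eval p x r y s t`: the program `p`, started on the input `x` when the outcomes of the coin
tosses still to come are listed in `r`, halts with output `y` after exactly `t` steps, and `s` is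
what remains of `r`, the outcomes used having been removed from the front. -/
inductive Eval : Prog → Data → List Bool → Data → List Bool → ℕ → Prop
  | id (x : Data) (r : List Bool) : Eval Prog.id x r x r 1
  | nil (x : Data) (r : List Bool) : Eval Prog.nil x r Data.nil r 1
  | fst (x : Data) (r : List Bool) : Eval Prog.fst x r x.fst r 1
  | snd (x : Data) (r : List Bool) : Eval Prog.snd x r x.snd r 1
  | flip (x : Data) (b : Bool) (r : List Bool) : Eval Prog.flip x (b :: r) (Data.ofBool b) r 1
  | pair {p q : Prog} {x y z : Data} {r₀ r₁ r₂ : List Bool} {t₁ t₂ : ℕ} :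
      Eval p x r₀ y r₁ t₁ → Eval q x r₁ z r₂ t₂ →
      Eval (Prog.pair p q) x r₀ (Data.cons y z) r₂ (t₁ + t₂ + 1)
  | seq {p q : Prog} {x y z : Data} {r₀ r₁ r₂ : List Bool} {t₁ t₂ : ℕ} :
      Eval p x r₀ y r₁ t₁ → Eval q y r₁ z r₂ t₂ →
      Eval (Prog.seq p q) x r₀ z r₂ (t₁ + t₂ + 1)
  | ite_true {b p q : Prog} {x v y : Data} {r₀ r₁ r₂ : List Bool} {t₁ t₂ : ℕ} :
      Eval b x r₀ v r₁ t₁ → v ≠ Data.nil → Eval p x r₁ y r₂ t₂ →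
      Eval (Prog.ite b p q) x r₀ y r₂ (t₁ + t₂ + 1)
  | ite_false {b p q : Prog} {x y : Data} {r₀ r₁ r₂ : List Bool} {t₁ t₂ : ℕ} :
      Eval b x r₀ Data.nil r₁ t₁ → Eval q x r₁ y r₂ t₂ →
      Eval (Prog.ite b p q) x r₀ y r₂ (t₁ + t₂ + 1)
  | loop_done {b p : Prog} {x : Data} {r₀ r₁ : List Bool} {t : ℕ} :
      Eval b x r₀ Data.nil r₁ t →
      Eval (Prog.loop b p) x r₀ x r₁ (t + 1)
  | loop_step {b p : Prog} {x v y z : Data} {r₀ r₁ r₂ r₃ : List Bool} {t₁ t₂ t₃ : ℕ} :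
      Eval b x r₀ v r₁ t₁ → v ≠ Data.nil → Eval p x r₁ y r₂ t₂ →
      Eval (Prog.loop b p) y r₂ z r₃ t₃ →
      Eval (Prog.loop b p) x r₀ z r₃ (t₁ + t₂ + t₃ + 1)

/-- On input `x`, with the coin outcomes `r`, the program halts within `T` steps with answer `a`. -/
def Prog.Answers (p : Prog) (x : Data) (T : ℕ) (r : List Bool) (a : Bool) : Prop :=
  ∃ (s : List Bool) (t : ℕ), t ≤ T ∧ Eval p x r (Data.ofBool a) s t

/-- The probability that `p` gives the answer `a` on input `x` within `T` steps.  As each coin toss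
is a step, at most `T` coins are tossed in that time, so the probability is taken over a uniformly
random string of `T` coin outcomes. -/
noncomputable def Prog.answerProb (p : Prog) (x : Data) (T : ℕ) (a : Bool) : ℝ :=
  (Nat.card {r : Fin T → Bool // p.Answers x T (List.ofFn r) a} : ℝ) / 2 ^ T

/-- On input `x`, the randomized program `p` decides the question `Q` in time `T` with false
negatives: whatever the coins, it halts within `T` steps with an answer YES or NO; if `Q` fails, the
answer is always NO; if `Q` holds, the answer is NO with probability at most `1/2`. -/
def Prog.DecidesWithFalseNegatives (p : Prog) (x : Data) (Q : Prop) (T : ℕ) : Prop :=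
  (∀ r : Fin T → Bool, ∃ a : Bool, p.Answers x T (List.ofFn r) a) ∧
  (¬ Q → ∀ r : Fin T → Bool, p.Answers x T (List.ofFn r) false) ∧
  (Q → p.answerProb x T false ≤ 1 / 2)

/-! ### The input -/

open Classical in
/-- A graph on the vertices `0, …, n - 1`, given by its adjacency matrix, row by row. -/
noncomputable def encodeGraph {n : ℕ} (G : SimpleGraph (Fin n)) : Data :=
  Data.ofList (List.ofFn fun i : Fin n =>
    Data.ofList (List.ofFn fun j : Fin n => Data.ofBool (decide (G.Adj i j))))

/-- The number of connected components of a finite graph. -/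
noncomputable def cc {V : Type*} (H : SimpleGraph V) : ℕ :=
  Nat.card H.ConnectedComponent

/-!
Removing an arc `v → w` from a forest host `G` cuts off a branch behind it, and the branches behind
the arcs from `w` to its further neighbors are disjoint. The pattern `H` gets an extra isolated
vertex, which stands for "no vertex is placed here". The value of a pattern arc `a → x` at a host
arc `v → w` is, recursively, the determinant of a matrix indexed by `V(G) ⊕ V(H)`: its perfect
matchings send the further neighbors of `x` to distinct further neighbors of `w`, and every further
neighbor of `w` that is not used contributes a value of its branch, into which a whole component of
`H` is then placed by choosing the vertex that goes to the root of the branch. Since `G` is a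
forest, this is a polynomial of low degree in one variable for each pair of a pattern vertex and
a host vertex; since walks of `G` that never turn back end, components of `H` with a cycle
contribute nothing.

A nonzero term may use some components several times and others not at all. Let `t` be a set of
components, and switch off the variables that place roots in components outside `t`. As a function
of `t`, the product of the values of all components of `G` becomes a linear combination of the
indicators of `S ⊆ t`, over sets `S` of components that embed disjointly into `G`. The alternating
sum over all `2 ^ k` sets `t` retains only the `S` that contains all components, so it vanishes if
`H` has no copy in `G`. Conversely, given a copy, evaluate at the point that lets each host vertex
receive only its preimage, or the extra vertex if there is none: each determinant then has a single
nonzero term, and the alternating sum is nonzero.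

It remains to test whether a polynomial is zero, at a random point modulo a prime that exceeds
twice its degree. The determinants are computed without divisions by Bird's algorithm, and
`2 ^ k ≤ 2 * 2 ^ (k * log k)` accounts for the number of sets `t`.
-/

/-! ### Bird's division-free determinant algorithm -/

section Bird

open Finset Matrix

theorem sum_powersetCard_sum_insert {ι M : Type*} [DecidableEq ι] [AddCommMonoid M]
    (f : ι → Finset ι → M) (s : Finset ι) (p : ℕ) :
    ∑ r ∈ s, ∑ α ∈ powersetCard p s, (if r ∈ α then 0 else f r (insert r α))
      = ∑ β ∈ powersetCard (p + 1) s, ∑ r ∈ β, f r β := by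
  simp_rw [← ite_not (_ ∈ _), ← sum_filter]
  rw [sum_sigma', sum_sigma']
  refine sum_bij' (fun x _ => ⟨insert x.1 x.2, x.1⟩) (fun y _ => ⟨y.2, y.1.erase y.2⟩)
    ?_ ?_ ?_ ?_ fun _ _ => rfl
  all_goals simp only [mem_sigma, mem_filter, mem_powersetCard]
  · rintro ⟨r, α⟩ ⟨hr, ⟨hα, hcard⟩, hrα⟩
    exact ⟨⟨insert_subset hr hα, by rw [card_insert_of_notMem hrα, hcard]⟩, mem_insert_self _ _⟩
  · rintro ⟨β, r⟩ ⟨⟨hβ, hcard⟩, hr⟩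
    exact ⟨hβ hr, ⟨(erase_subset _ _).trans hβ, by rw [card_erase_of_mem hr, hcard]; rfl⟩,
      notMem_erase _ _⟩
  · rintro ⟨r, α⟩ ⟨-, -, hrα⟩
    simp [erase_insert hrα]
  · rintro ⟨β, r⟩ ⟨-, hr⟩
    simp [insert_erase hr]

section Minors

variable {ι R : Type*} [DecidableEq ι] [CommRing R]

/-- The matrix whose rows with index in `α` are those of `A`, the others being those of the
identity; its determinant is the principal minor of `A` on `α`. -/
def partialRows (A : Matrix ι ι R) (α : Finset ι) : Matrix ι ι R :=
  of fun r => if r ∈ α then A r else Pi.single r 1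

theorem partialRows_empty (A : Matrix ι ι R) : partialRows A ∅ = 1 := by
  ext r s
  simp [partialRows, one_apply, Pi.single_apply, eq_comm]

theorem partialRows_insert_updateRow (A : Matrix ι ι R) (α : Finset ι) (r : ι) (b : ι → R) :
    (partialRows A (insert r α)).updateRow r b = (partialRows A α).updateRow r b := by
  ext s t
  rcases eq_or_ne s r with rfl | hs
  · simp
  · simp [partialRows, hs]

variable [Fintype ι]

theorem partialRows_univ (A : Matrix ι ι R) : partialRows A univ = A := by
  ext r s
  simp [partialRows]

/-- The minor of `A` with rows `α ∪ {i}` and columns `α ∪ {j}`, up to the order of the rows;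
it is meaningful for `i ∉ α`. -/
def borderedMinor (A : Matrix ι ι R) (α : Finset ι) (i j : ι) : R :=
  if j ∈ α then 0 else ((partialRows A α).updateRow j (A i)).det

theorem borderedMinor_self (A : Matrix ι ι R) {α : Finset ι} {r : ι} (hr : r ∉ α) :
    borderedMinor A α r r = (partialRows A (insert r α)).det := by
  have hrow : partialRows A (insert r α) r = A r := if_pos (mem_insert_self r α)
  rw [borderedMinor, if_neg hr, ← partialRows_insert_updateRow, ← hrow, updateRow_eq_self]

theorem borderedMinor_expand (A : Matrix ι ι R) (β : Finset ι) (i j : ι) :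
    borderedMinor A β i j = A i j * (partialRows A β).det
      - ∑ r ∈ β, A r j * ((partialRows A β).updateRow r (A i)).det := by
  have cramer := congrFun (mulVec_cramer (partialRows A β)ᵀ (A i)) j
  simp only [mulVec, dotProduct, cramer_transpose_apply, transpose_apply, det_transpose,
    Pi.smul_apply, smul_eq_mul] at cramer
  have inside : ∑ r ∈ β, partialRows A β r j * ((partialRows A β).updateRow r (A i)).det
      = ∑ r ∈ β, A r j * ((partialRows A β).updateRow r (A i)).det :=
    sum_congr rfl fun r hr => by simp [partialRows, hr]
  have outside : ∑ r ∈ βᶜ, partialRows A β r j * ((partialRows A β).updateRow r (A i)).det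
      = borderedMinor A β i j := by
    have entry : ∀ r ∈ βᶜ, partialRows A β r j = if j = r then 1 else 0 := fun r hr => by
      simp [partialRows, mem_compl.1 hr, Pi.single_apply]
    rw [sum_congr rfl fun r hr => by rw [entry r hr]]
    simp [borderedMinor, ite_not]
  rw [mul_comm (A i j), ← cramer, ← sum_add_sum_compl β, inside, outside, add_sub_cancel_left]

theorem sum_borderedMinor_mul (A : Matrix ι ι R) (s : Finset ι) (p : ℕ) (i j : ι) :
    ∑ r ∈ s, (∑ α ∈ powersetCard p s, borderedMinor A α i r) * A r j
      = ∑ β ∈ powersetCard (p + 1) s,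
          ∑ r ∈ β, A r j * ((partialRows A β).updateRow r (A i)).det := by
  rw [← sum_powersetCard_sum_insert]
  refine sum_congr rfl fun r _ => ?_
  rw [sum_mul]
  refine sum_congr rfl fun α _ => ?_
  rw [borderedMinor, partialRows_insert_updateRow]
  split_ifs <;> ring

end Minors

variable {ι R : Type*} [LinearOrder ι] [LocallyFiniteOrderTop ι]

theorem notMem_of_subset_Ioi {r : ι} {α : Finset ι} (hα : α ⊆ Ioi r) : r ∉ α :=
  fun hr => notMem_Ioi_self (hα hr)

theorem min'_insert_of_subset_Ioi {r : ι} {α : Finset ι} (hα : α ⊆ Ioi r) :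
    (insert r α).min' (insert_nonempty r α) = r :=
  le_antisymm (min'_le _ _ (mem_insert_self r α)) <| le_min' _ _ _ fun _ hs =>
    (mem_insert.1 hs).elim ge_of_eq fun hsα => (mem_Ioi.1 (hα hsα)).le

theorem sum_Ioi_sum_powersetCard_insert {M : Type*} [AddCommMonoid M] (f : Finset ι → M) (i : ι)
    (p : ℕ) :
    ∑ r ∈ Ioi i, ∑ α ∈ powersetCard p (Ioi r), f (insert r α)
      = ∑ β ∈ powersetCard (p + 1) (Ioi i), f β := by
  rw [sum_sigma']
  have nonempty {β : Finset ι} (hβ : β ∈ powersetCard (p + 1) (Ioi i)) : β.Nonempty :=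
    card_pos.1 (by rw [(mem_powersetCard.1 hβ).2]; exact p.succ_pos)
  refine sum_bij' (fun x _ => insert x.1 x.2)
    (fun β hβ => ⟨β.min' (nonempty hβ), β.erase (β.min' (nonempty hβ))⟩) ?_ ?_ ?_ ?_
    fun _ _ => rfl
  · rintro ⟨r, α⟩ h
    simp only [mem_sigma, mem_Ioi, mem_powersetCard] at h ⊢
    obtain ⟨hir, hα, hcard⟩ := h
    exact ⟨insert_subset (mem_Ioi.2 hir) (hα.trans (Ioi_subset_Ioi hir.le)),
      by rw [card_insert_of_notMem (notMem_of_subset_Ioi hα), hcard]⟩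
  · intro β hβ
    have hmem := min'_mem β (nonempty hβ)
    rw [mem_powersetCard] at hβ
    simp only [mem_sigma, mem_powersetCard]
    refine ⟨hβ.1 hmem, fun s hs => mem_Ioi.2 (min'_lt_of_mem_erase_min' _ _ hs), ?_⟩
    rw [card_erase_of_mem hmem, hβ.2, Nat.add_sub_cancel]
  · rintro ⟨r, α⟩ h
    simp only [mem_sigma, mem_powersetCard] at h
    simp only [min'_insert_of_subset_Ioi h.2.1, erase_insert (notMem_of_subset_Ioi h.2.1)]
  · intro β hβ
    exact insert_erase (min'_mem β (nonempty hβ))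

variable [CommRing R]

/-- One round `X ↦ μ(X) A` of Bird's determinant algorithm: `μ(X)` is the strictly upper triangular
part of `-X`, with the diagonal entry `∑ r > i, X r r` in row `i`. -/
def birdStep (A X : Matrix ι ι R) : Matrix ι ι R :=
  of fun i j => (∑ r ∈ Ioi i, X r r) * A i j - ∑ r ∈ Ioi i, X i r * A r j

variable [Fintype ι]

theorem sum_Ioi_borderedMinor_self (A : Matrix ι ι R) (p : ℕ) (i : ι) :
    ∑ r ∈ Ioi i, ∑ α ∈ powersetCard p (Ioi r), borderedMinor A α r r
      = ∑ β ∈ powersetCard (p + 1) (Ioi i), (partialRows A β).det := by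
  rw [← sum_Ioi_sum_powersetCard_insert]
  exact sum_congr rfl fun r _ => sum_congr rfl fun α hα =>
    borderedMinor_self A (notMem_of_subset_Ioi (mem_powersetCard.1 hα).1)

theorem birdStep_sum_borderedMinor (A : Matrix ι ι R) (p : ℕ) :
    birdStep A (of fun i j => ∑ α ∈ powersetCard p (Ioi i), borderedMinor A α i j)
      = of fun i j => ∑ α ∈ powersetCard (p + 1) (Ioi i), borderedMinor A α i j := by
  ext i j
  simp only [birdStep, of_apply]
  rw [sum_Ioi_borderedMinor_self, sum_borderedMinor_mul, sum_mul, ← sum_sub_distrib]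
  exact sum_congr rfl fun β _ => by rw [borderedMinor_expand, mul_comm]

theorem birdStep_iterate (A : Matrix ι ι R) (p : ℕ) :
    (birdStep A)^[p] A = of fun i j => ∑ α ∈ powersetCard p (Ioi i), borderedMinor A α i j := by
  induction p with
  | zero =>
    ext i j
    simp [borderedMinor_expand, partialRows_empty]
  | succ p ih => rw [Function.iterate_succ_apply', ih, birdStep_sum_borderedMinor]

theorem birdStep_iterate_bot_eq_det [OrderBot ι] (A : Matrix ι ι R) :
    (birdStep A)^[Fintype.card ι - 1] A ⊥ ⊥ = A.det := by
  have huniv : insert ⊥ (Ioi (⊥ : ι)) = univ := by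
    ext s
    simp
  have hcard : #(Ioi (⊥ : ι)) = Fintype.card ι - 1 := by
    rw [← card_univ, ← huniv, card_insert_of_notMem notMem_Ioi_self, Nat.add_sub_cancel]
  rw [birdStep_iterate, of_apply, ← hcard, powersetCard_self, sum_singleton,
    borderedMinor_self A notMem_Ioi_self, huniv, partialRows_univ]

end Bird

/-! ### Computation without coin tosses -/

/-- On input `x`, the program `p` returns `y` within `T` steps and tosses no coin. -/
def Prog.Computes (p : Prog) (x y : Data) (T : ℕ) : Prop :=
  ∃ t ≤ T, ∀ r, Eval p x r y r t

namespace Prog.Computes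

variable {p q b : Prog} {x y z : Data} {S T U : ℕ}

theorem mono (h : p.Computes x y S) (hST : S ≤ T) : p.Computes x y T :=
  let ⟨t, ht, h⟩ := h
  ⟨t, ht.trans hST, h⟩

theorem pair (hp : p.Computes x y S) (hq : q.Computes x z T) :
    (p.pair q).Computes x (.cons y z) (S + T + 1) := by
  obtain ⟨s, hs, hp⟩ := hp
  obtain ⟨t, ht, hq⟩ := hq
  exact ⟨s + t + 1, by omega, fun r => .pair (hp r) (hq r)⟩

theorem seq (hp : p.Computes x y S) (hq : q.Computes y z T) :
    (p.seq q).Computes x z (S + T + 1) := by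
  obtain ⟨s, hs, hp⟩ := hp
  obtain ⟨t, ht, hq⟩ := hq
  exact ⟨s + t + 1, by omega, fun r => .seq (hp r) (hq r)⟩

theorem ite_true (hb : b.Computes x z S) (hz : z ≠ .nil) (hp : p.Computes x y T) :
    (b.ite p q).Computes x y (S + T + 1) := by
  obtain ⟨s, hs, hb⟩ := hb
  obtain ⟨t, ht, hp⟩ := hp
  exact ⟨s + t + 1, by omega, fun r => .ite_true (hb r) hz (hp r)⟩

theorem ite_false (hb : b.Computes x .nil S) (hq : q.Computes x y T) :
    (b.ite p q).Computes x y (S + T + 1) := by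
  obtain ⟨s, hs, hb⟩ := hb
  obtain ⟨t, ht, hq⟩ := hq
  exact ⟨s + t + 1, by omega, fun r => .ite_false (hb r) (hq r)⟩

theorem loop_done (hb : b.Computes x .nil S) : (b.loop p).Computes x x (S + 1) := by
  obtain ⟨s, hs, hb⟩ := hb
  exact ⟨s + 1, by omega, fun r => .loop_done (hb r)⟩

theorem loop_step {v : Data} (hb : b.Computes x v S) (hv : v ≠ .nil) (hp : p.Computes x y T)
    (hl : (b.loop p).Computes y z U) : (b.loop p).Computes x z (S + T + U + 1) := by
  obtain ⟨s, hs, hb⟩ := hb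
  obtain ⟨t, ht, hp⟩ := hp
  obtain ⟨u, hu, hl⟩ := hl
  exact ⟨s + t + u + 1, by omega, fun r => .loop_step (hb r) hv (hp r) (hl r)⟩

theorem loop {v w : ℕ → Data} {n : ℕ} (hb : ∀ i ≤ n, b.Computes (w i) (v i) S)
    (hp : ∀ i < n, p.Computes (w i) (w (i + 1)) T) (hv : ∀ i < n, v i ≠ .nil) (hn : v n = .nil) :
    (b.loop p).Computes (w 0) (w n) (n * (S + T + 1) + S + 1) := by
  induction n generalizing v w with
  | zero => exact (hn ▸ hb 0 le_rfl : b.Computes (w 0) .nil S).loop_done.mono (by omega)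
  | succ n ih =>
    have rest := ih (v := fun i => v (i + 1)) (w := fun i => w (i + 1))
      (fun i hi => hb _ (by omega)) (fun i hi => hp _ (by omega)) (fun i hi => hv _ (by omega)) hn
    refine (loop_step (hb 0 (by omega)) (hv 0 n.succ_pos) (hp 0 n.succ_pos) rest).mono ?_
    rw [Nat.succ_mul]
    omega

end Prog.Computes

theorem Prog.exists_computes_const (y : Data) : ∃ p T, ∀ x, Prog.Computes p x y T := by
  induction y with
  | nil => exact ⟨.nil, 1, fun x => ⟨1, le_rfl, fun r => .nil x r⟩⟩
  | cons y z hy hz =>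
    obtain ⟨p, S, hp⟩ := hy
    obtain ⟨q, T, hq⟩ := hz
    exact ⟨p.pair q, S + T + 1, fun x => (hp x).pair (hq x)⟩

/-! ### Polynomial time functions -/

/-- Types whose elements are represented by data. The size is the number in terms of which running
times are measured; it need not be the number of nodes of the code. -/
class Coded (α : Type) where
  code : α → Data
  size : α → ℕ

namespace Coded

variable {α β : Type} [Coded α] [Coded β]

instance : Coded Bool := ⟨Data.ofBool, fun _ => 0⟩

instance : Coded ℕ := ⟨fun n => n.rec .nil fun _ d => .cons .nil d, fun n => n⟩

instance : Coded (α × β) := ⟨fun x => .cons (code x.1) (code x.2), fun x => size x.1 + size x.2⟩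

instance : Coded (List α) := ⟨fun l => .ofList (l.map code), fun l => (l.map (size · + 1)).sum⟩

@[simp] theorem size_nat (n : ℕ) : size n = n := rfl

@[simp] theorem size_bool (b : Bool) : size b = 0 := rfl

@[simp] theorem size_prod (a : α) (b : β) : size (a, b) = size a + size b := rfl

@[simp] theorem size_nil : size ([] : List α) = 0 := rfl

@[simp] theorem size_cons (a : α) (l : List α) : size (a :: l) = size a + 1 + size l := rfl

theorem size_list_bool (l : List Bool) : size l = l.length := by
  induction l with
  | nil => rfl
  | cons b l ih => rw [size_cons, size_bool, ih, List.length_cons, zero_add, add_comm]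

theorem length_le_size (l : List α) : l.length ≤ size l := by
  induction l with
  | nil => rfl
  | cons a l ih =>
    rw [List.length_cons, size_cons]
    omega

theorem size_drop_le (l : List α) (i : ℕ) : size (l.drop i) ≤ size l := by
  induction i generalizing l with
  | zero => rfl
  | succ i ih =>
    cases l with
    | nil => rfl
    | cons a l => exact (ih l).trans (by simp)

theorem size_map_le {ι : Type*} {f : ι → β} {l : List ι} {S : ℕ} (h : ∀ i ∈ l, size (f i) ≤ S) :
    size (l.map f) ≤ l.length * (S + 1) := by
  induction l with
  | nil => simp
  | cons i l ih =>
    have hi := h i List.mem_cons_self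
    have hl := ih fun j hj => h j (List.mem_cons_of_mem _ hj)
    rw [List.map_cons, size_cons, List.length_cons, Nat.succ_mul]
    omega

end Coded

open Coded

/-- The function `f` is polynomially bounded in terms of the size of its argument. -/
def PolyBounded {α : Type} [Coded α] (f : α → ℕ) : Prop :=
  ∃ c : ℕ, ∀ a, f a ≤ (size a + 2) ^ c

namespace PolyBounded

variable {α β : Type} [Coded α] [Coded β] {f g : α → ℕ}

theorem mono (hg : PolyBounded g) (h : ∀ a, f a ≤ g a) : PolyBounded f :=
  let ⟨c, hc⟩ := hg
  ⟨c, fun a => (h a).trans (hc a)⟩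

theorem const (k : ℕ) : PolyBounded fun _ : α => k :=
  ⟨k, fun _ => Nat.lt_two_pow_self.le.trans (Nat.pow_le_pow_left (by omega) k)⟩

theorem size : PolyBounded (size : α → ℕ) :=
  ⟨1, fun a => by simp⟩

theorem mul (hf : PolyBounded f) (hg : PolyBounded g) : PolyBounded fun a => f a * g a := by
  obtain ⟨c, hc⟩ := hf
  obtain ⟨d, hd⟩ := hg
  exact ⟨c + d, fun a => by rw [pow_add]; exact Nat.mul_le_mul (hc a) (hd a)⟩

theorem add (hf : PolyBounded f) (hg : PolyBounded g) : PolyBounded fun a => f a + g a := by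
  obtain ⟨c, hc⟩ := hf.mul (.const 1)
  obtain ⟨d, hd⟩ := hg.mul (.const 1)
  refine ⟨max c d + 1, fun a => ?_⟩
  calc f a + g a ≤ (Coded.size a + 2) ^ max c d + (Coded.size a + 2) ^ max c d := by
        refine add_le_add ((le_of_eq (mul_one _).symm).trans (hc a) |>.trans ?_)
          ((le_of_eq (mul_one _).symm).trans (hd a) |>.trans ?_)
        · exact Nat.pow_le_pow_right (by omega) (le_max_left c d)
        · exact Nat.pow_le_pow_right (by omega) (le_max_right c d)
    _ = (Coded.size a + 2) ^ max c d * 2 := (mul_two _).symm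
    _ ≤ (Coded.size a + 2) ^ (max c d + 1) := Nat.mul_le_mul_left _ (by omega)

theorem exists_forall_le_of_size_le {T : β → ℕ} (hT : PolyBounded T) (hf : PolyBounded f) :
    ∃ S : α → ℕ, PolyBounded S ∧ ∀ a b, Coded.size b ≤ f a → T b ≤ S a := by
  obtain ⟨c, hc⟩ := hT
  obtain ⟨d, hd⟩ := hf.add (const 2)
  exact ⟨fun a => (f a + 2) ^ c, ⟨d * c, fun a => by
    rw [pow_mul]; exact Nat.pow_le_pow_left (hd a) c⟩,
    fun a b h => (hc b).trans (Nat.pow_le_pow_left (by omega) c)⟩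

theorem comp {T : β → ℕ} {u : α → β} (hT : PolyBounded T)
    (hu : PolyBounded fun a => Coded.size (u a)) : PolyBounded fun a => T (u a) :=
  let ⟨_, hS, hTS⟩ := hT.exists_forall_le_of_size_le hu
  hS.mono fun a => hTS a (u a) le_rfl

end PolyBounded

/-- The function `f` has values of polynomial size and is computed in polynomial time, in terms of
the size of its argument, by a program that tosses no coin. -/
@[fun_prop]
def PolyTime {α β : Type} [Coded α] [Coded β] (f : α → β) : Prop :=
  ∃ (p : Prog) (T : α → ℕ), PolyBounded T ∧ (PolyBounded fun a => size (f a)) ∧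
    ∀ a, p.Computes (code a) (code (f a)) (T a)

namespace PolyTime

variable {α β γ σ : Type} [Coded α] [Coded β] [Coded γ] [Coded σ]

theorem polyBounded {f : α → β} (hf : PolyTime f) : PolyBounded fun a => size (f a) :=
  let ⟨_, _, _, h, _⟩ := hf
  h

theorem of_eq {f g : α → β} (hf : PolyTime f) (h : ∀ a, f a = g a) : PolyTime g :=
  (funext h : f = g) ▸ hf

@[fun_prop]
theorem id : PolyTime fun a : α => a :=
  ⟨.id, fun _ => 1, .const 1, .size, fun _ => ⟨1, le_rfl, fun _ => .id _ _⟩⟩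

@[fun_prop]
theorem const (b : β) : PolyTime fun _ : α => b :=
  let ⟨p, T, hp⟩ := Prog.exists_computes_const (code b)
  ⟨p, fun _ => T, .const T, .const _, fun _ => hp _⟩

@[fun_prop]
theorem comp {g : β → γ} {f : α → β} (hg : PolyTime g) (hf : PolyTime f) :
    PolyTime fun a => g (f a) := by
  obtain ⟨p, S, hS, hfs, hp⟩ := hf
  obtain ⟨q, T, hT, hgs, hq⟩ := hg
  exact ⟨p.seq q, fun a => S a + T (f a) + 1, (hS.add (hT.comp hfs)).add (.const 1), hgs.comp hfs,
    fun a => (hp a).seq (hq (f a))⟩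

@[fun_prop]
theorem pair {f : α → β} {g : α → γ} (hf : PolyTime f) (hg : PolyTime g) :
    PolyTime fun a => (f a, g a) := by
  obtain ⟨p, S, hS, hfs, hp⟩ := hf
  obtain ⟨q, T, hT, hgs, hq⟩ := hg
  exact ⟨p.pair q, fun a => S a + T a + 1, (hS.add hT).add (.const 1), hfs.add hgs,
    fun a => (hp a).pair (hq a)⟩

@[fun_prop]
theorem fst {f : α → β × γ} (hf : PolyTime f) : PolyTime fun a => (f a).1 := by
  have hfst : PolyTime fun x : β × γ => x.1 :=
    ⟨.fst, fun _ => 1, .const 1, PolyBounded.size.mono fun _ => Nat.le_add_right _ _,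
      fun _ => ⟨1, le_rfl, fun _ => .fst _ _⟩⟩
  exact hfst.comp hf

@[fun_prop]
theorem snd {f : α → β × γ} (hf : PolyTime f) : PolyTime fun a => (f a).2 := by
  have hsnd : PolyTime fun x : β × γ => x.2 :=
    ⟨.snd, fun _ => 1, .const 1, PolyBounded.size.mono fun _ => Nat.le_add_left _ _,
      fun _ => ⟨1, le_rfl, fun _ => .snd _ _⟩⟩
  exact hsnd.comp hf

theorem cond {b : α → Bool} {f g : α → β} (hb : PolyTime b) (hf : PolyTime f)
    (hg : PolyTime g) : PolyTime fun a => bif b a then f a else g a := by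
  obtain ⟨o, R, hR, -, ho⟩ := hb
  obtain ⟨p, S, hS, hfs, hp⟩ := hf
  obtain ⟨q, T, hT, hgs, hq⟩ := hg
  refine ⟨o.ite p q, fun a => R a + (S a + T a) + 1, (hR.add (hS.add hT)).add (.const 1),
    (hfs.add hgs).mono fun a => by cases h : b a <;> simp [h], fun a => ?_⟩
  have ho := ho a
  cases hba : b a <;> simp only [hba, cond_true, cond_false] at ho ⊢
  · refine (ho.ite_false (hq a)).mono ?_
    omega
  · refine (ho.ite_true nofun (hp a)).mono ?_
    omega

@[fun_prop]
theorem ite {P : α → Prop} [DecidablePred P] {f g : α → β} (hP : PolyTime fun a => decide (P a))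
    (hf : PolyTime f) (hg : PolyTime g) : PolyTime fun a => if P a then f a else g a :=
  (hP.cond hf hg).of_eq fun a => by by_cases h : P a <;> simp [h]

@[fun_prop]
theorem decide_bool {b : α → Bool} (hb : PolyTime b) : PolyTime fun a => decide (b a = true) :=
  hb.of_eq fun a => by simp

@[fun_prop]
theorem decide_and {P Q : α → Prop} [DecidablePred P] [DecidablePred Q]
    (hP : PolyTime fun a => decide (P a)) (hQ : PolyTime fun a => decide (Q a)) :
    PolyTime fun a => decide (P a ∧ Q a) :=
  (hP.cond hQ (.const false)).of_eq fun a => by by_cases h : P a <;> simp [h]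

@[fun_prop]
theorem decide_or {P Q : α → Prop} [DecidablePred P] [DecidablePred Q]
    (hP : PolyTime fun a => decide (P a)) (hQ : PolyTime fun a => decide (Q a)) :
    PolyTime fun a => decide (P a ∨ Q a) :=
  (hP.cond (.const true) hQ).of_eq fun a => by by_cases h : P a <;> simp [h]

@[fun_prop]
theorem decide_not {P : α → Prop} [DecidablePred P] (hP : PolyTime fun a => decide (P a)) :
    PolyTime fun a => decide (¬P a) :=
  (hP.cond (.const false) (.const true)).of_eq fun a => by by_cases h : P a <;> simp [h]

@[fun_prop]
theorem cons {f : α → β} {g : α → List β} (hf : PolyTime f) (hg : PolyTime g) :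
    PolyTime fun a => f a :: g a := by
  obtain ⟨p, T, hT, hs, hp⟩ := hf.pair hg
  exact ⟨p, T, hT, (hs.add (.const 1)).mono fun a => by simp; omega, hp⟩

@[fun_prop]
theorem tail {f : α → List β} (hf : PolyTime f) : PolyTime fun a => (f a).tail := by
  have htail : PolyTime fun l : List β => l.tail :=
    ⟨.snd, fun _ => 1, .const 1, PolyBounded.size.mono fun l => by cases l <;> simp,
      fun l => ⟨1, le_rfl, fun r => by cases l <;> exact .snd _ r⟩⟩
  exact htail.comp hf

theorem headD {f : α → List β} (hf : PolyTime f) {d : β} (hd : code d = .nil) :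
    PolyTime fun a => (f a).headD d := by
  have hhead : PolyTime fun l : List β => l.headD d := by
    refine ⟨.fst, fun _ => 1, .const 1, (PolyBounded.size.add (.const (size d))).mono fun l => ?_,
      fun l => ⟨1, le_rfl, fun r => ?_⟩⟩
    · cases l <;> simp; omega
    · cases l with
      | nil => exact hd.symm ▸ Eval.fst _ r
      | cons a l => exact .fst _ r
  exact hhead.comp hf

@[fun_prop]
theorem succ {f : α → ℕ} (hf : PolyTime f) : PolyTime fun a => f a + 1 := by
  obtain ⟨p, T, hT, hs, hp⟩ := hf
  exact ⟨.pair .nil p, fun a => 1 + T a + 1, (PolyBounded.add (.const 1) hT).add (.const 1),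
    hs.add (.const 1), fun a => .pair ⟨1, le_rfl, fun _ => .nil _ _⟩ (hp a)⟩

@[fun_prop]
theorem pred {f : α → ℕ} (hf : PolyTime f) : PolyTime fun a => f a - 1 := by
  have hpred : PolyTime fun n : ℕ => n - 1 :=
    ⟨.snd, fun _ => 1, .const 1, PolyBounded.size.mono fun n => Nat.sub_le n 1,
      fun n => ⟨1, le_rfl, fun r => by cases n <;> exact .snd _ r⟩⟩
  exact hpred.comp hf

theorem decide_ne_zero {f : α → ℕ} (hf : PolyTime f) : PolyTime fun a => decide (f a ≠ 0) := by
  obtain ⟨p, T, hT, -, hp⟩ := hf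
  have answer (b : Bool) : PolyTime fun _ : α => b := .const b
  obtain ⟨q, S, hS, -, hq⟩ := answer true
  obtain ⟨q', S', hS', -, hq'⟩ := answer false
  refine ⟨p.ite q q', fun a => T a + (S a + S' a) + 1, (hT.add (hS.add hS')).add (.const 1),
    .const 0, fun a => ?_⟩
  have hp := hp a
  cases hfa : f a <;> simp only [hfa] at hp ⊢
  · refine (hp.ite_false (hq' a)).mono ?_
    omega
  · refine (hp.ite_true nofun (hq a)).mono ?_
    omega

theorem of_loop {τ : Type} [Coded τ] {w : α → ℕ → σ} {n : α → ℕ} {test : σ → τ} {step : σ → σ}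
    (hw : PolyTime fun a => w a 0) (htest : PolyTime test) (hstep : PolyTime step)
    (hn : PolyBounded n) {B : α → ℕ} (hB : PolyBounded B)
    (hsize : ∀ a, ∀ i ≤ n a, size (w a i) ≤ B a)
    (hnext : ∀ a, ∀ i < n a, step (w a i) = w a (i + 1))
    (test_ne_nil : ∀ a, ∀ i < n a, code (test (w a i)) ≠ .nil)
    (test_eq_nil : ∀ a, code (test (w a (n a))) = .nil) : PolyTime fun a => w a (n a) := by
  obtain ⟨o, R, hR, -, ho⟩ := hw
  obtain ⟨b, S, hS, -, hb⟩ := htest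
  obtain ⟨p, T, hT, -, hp⟩ := hstep
  obtain ⟨S', hS', hSS'⟩ := hS.exists_forall_le_of_size_le hB
  obtain ⟨T', hT', hTT'⟩ := hT.exists_forall_le_of_size_le hB
  refine ⟨o.seq (b.loop p), fun a => R a + (n a * (S' a + T' a + 1) + S' a + 1) + 1,
    (hR.add (((hn.mul ((hS'.add hT').add (.const 1))).add hS').add (.const 1))).add (.const 1),
    hB.mono fun a => hsize a _ le_rfl, fun a => ?_⟩
  refine (ho a).seq (.loop (w := fun i => code (w a i)) (v := fun i => code (test (w a i)))
    (fun i hi => (hb _).mono (hSS' a _ (hsize a i hi))) (fun i hi => ?_)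
    (test_ne_nil a) (test_eq_nil a))
  exact hnext a i hi ▸ (hp (w a i)).mono (hTT' a _ (hsize a i hi.le))

theorem of_recurrence {u : α → ℕ → σ} {n : α → ℕ} {F : α → ℕ → σ → σ} (hn : PolyTime n)
    (hu : PolyTime fun a => u a 0) (hF : PolyTime fun x : α × ℕ × σ => F x.1 x.2.1 x.2.2)
    (hnext : ∀ a, ∀ i < n a, u a (i + 1) = F a i (u a i)) {B : α → ℕ} (hB : PolyBounded B)
    (hsize : ∀ a, ∀ i ≤ n a, size (u a i) ≤ B a) : PolyTime fun a => u a (n a) := by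
  have : PolyTime fun x : α × ℕ × ℕ × σ => F x.1 x.2.1 x.2.2.2 :=
    hF.comp (f := fun x : α × ℕ × ℕ × σ => (x.1, x.2.1, x.2.2.2)) (by fun_prop)
  have hloop : PolyTime fun a => (a, n a, n a - n a, u a (n a)) :=
    of_loop (w := fun a i => (a, i, n a - i, u a i)) (test := fun x => x.2.2.1)
      (step := fun x => (x.1, x.2.1 + 1, x.2.2.1 - 1, F x.1 x.2.1 x.2.2.2))
      (by simpa only [Nat.sub_zero] using (by fun_prop : PolyTime fun a => (a, 0, n a, u a 0)))
      (by fun_prop) (by fun_prop) hn.polyBounded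
      (((PolyBounded.size.add hn.polyBounded).add hn.polyBounded).add hB)
      (fun a i hi => by have := hsize a i hi; simp only [size_prod, size_nat]; omega)
      (fun a i hi => by simp [hnext a i hi, Nat.sub_sub])
      (fun a i hi => by
        obtain ⟨m, hm⟩ := Nat.exists_eq_add_of_lt hi
        simp [show n a - i = m + 1 by omega])
      (fun a => by simp only [Nat.sub_self]; rfl)
  exact hloop.snd.snd.snd

end PolyTime

namespace PolyTime

variable {α β σ : Type} [Coded α] [Coded β] [Coded σ]

theorem exists_forall_lt_size_le {f : α → ℕ → β} {n : α → ℕ} (hn : PolyTime n)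
    (hf : PolyTime fun x : α × ℕ => f x.1 x.2) :
    ∃ B : α → ℕ, PolyBounded B ∧ ∀ a, ∀ i < n a, size (f a i) ≤ B a := by
  obtain ⟨B, hB, h⟩ :=
    hf.polyBounded.exists_forall_le_of_size_le (PolyBounded.size.add hn.polyBounded)
  exact ⟨B, hB, fun a i hi => h a (a, i) (Nat.add_le_add_left hi.le _)⟩

theorem iterate {F : α → σ → σ} {n : α → ℕ} {s : α → σ} (hn : PolyTime n) (hs : PolyTime s)
    (hF : PolyTime fun x : α × σ => F x.1 x.2) {B : α → ℕ} (hB : PolyBounded B)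
    (hsize : ∀ a s, size (F a s) ≤ B a) : PolyTime fun a => (F a)^[n a] (s a) := by
  refine of_recurrence (u := fun a i => (F a)^[i] (s a)) (F := fun a _ => F a) hn hs
    (hF.comp (f := fun x : α × ℕ × σ => (x.1, x.2.2)) (by fun_prop))
    (fun a i _ => Function.iterate_succ_apply' ..) (hs.polyBounded.add hB) fun a i _ => ?_
  cases i with
  | zero => exact Nat.le_add_right _ _
  | succ i =>
    rw [Function.iterate_succ_apply']
    exact (hsize a _).trans (Nat.le_add_left _ _)

/-! ### Arithmetic in polynomial time -/

section Arithmetic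

variable {f g n : α → ℕ}

@[fun_prop]
theorem add (hf : PolyTime f) (hg : PolyTime g) : PolyTime fun a => f a + g a :=
  of_recurrence (u := fun a i => f a + i) (F := fun _ _ v => v + 1) hg hf (by fun_prop)
    (fun _ _ _ => rfl) (hf.polyBounded.add hg.polyBounded) fun _ _ hi => Nat.add_le_add_left hi _

@[fun_prop]
theorem sub (hf : PolyTime f) (hg : PolyTime g) : PolyTime fun a => f a - g a :=
  of_recurrence (u := fun a i => f a - i) (F := fun _ _ v => v - 1) hg hf (by fun_prop)
    (fun _ _ _ => rfl) hf.polyBounded fun _ _ _ => Nat.sub_le _ _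

@[fun_prop]
theorem mul (hf : PolyTime f) (hg : PolyTime g) : PolyTime fun a => f a * g a :=
  of_recurrence (u := fun a i => f a * i) (F := fun a _ v => v + f a) hg (.const 0) (by fun_prop)
    (fun _ _ _ => rfl) (hf.polyBounded.mul hg.polyBounded) fun _ _ hi => Nat.mul_le_mul_left _ hi

@[fun_prop]
theorem decide_lt (hf : PolyTime f) (hg : PolyTime g) : PolyTime fun a => decide (f a < g a) :=
  (hg.sub hf).decide_ne_zero.of_eq fun a => by simp [Nat.sub_eq_zero_iff_le]

@[fun_prop]
theorem decide_le (hf : PolyTime f) (hg : PolyTime g) : PolyTime fun a => decide (f a ≤ g a) :=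
  (hg.decide_lt hf).decide_not.of_eq fun a => by simp

@[fun_prop]
theorem decide_eq (hf : PolyTime f) (hg : PolyTime g) : PolyTime fun a => decide (f a = g a) :=
  ((hf.decide_le hg).decide_and (hg.decide_le hf)).of_eq fun a => by simp [le_antisymm_iff]

@[fun_prop]
theorem mod (hf : PolyTime f) (hg : PolyTime g) : PolyTime fun a => f a % g a := by
  refine of_recurrence (u := fun a i => i % g a)
    (F := fun a _ v => if v + 1 = g a then 0 else v + 1) hf (by simpa using const 0) (by fun_prop)
    (fun a i _ => ?_) hf.polyBounded fun a i hi => (Nat.mod_le i _).trans hi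
  rcases Nat.eq_zero_or_pos (g a) with hzero | hpos
  · simp [hzero]
  · split_ifs with h
    · rw [← Nat.mod_add_mod, h, Nat.mod_self]
    · rw [← Nat.mod_add_mod, Nat.mod_eq_of_lt]
      exact lt_of_le_of_ne (Nat.mod_lt i hpos) h

@[fun_prop]
theorem sum {f : α → ℕ → ℕ} (hn : PolyTime n) (hf : PolyTime fun x : α × ℕ => f x.1 x.2) :
    PolyTime fun a => ∑ i ∈ Finset.range (n a), f a i := by
  obtain ⟨B, hB, hfB⟩ := exists_forall_lt_size_le hn hf
  refine of_recurrence (u := fun a i => ∑ j ∈ Finset.range i, f a j) (F := fun a i v => v + f a i)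
    hn (.const 0) ?_ (fun a i _ => Finset.sum_range_succ ..) (hn.polyBounded.mul hB)
    fun a i hi => ?_
  · exact (by fun_prop : PolyTime fun x : α × ℕ × ℕ => x.2.2).add <|
      hf.comp (f := fun x : α × ℕ × ℕ => (x.1, x.2.1)) (by fun_prop)
  · calc ∑ j ∈ Finset.range i, f a j ≤ i * B a := by
          simpa using Finset.sum_le_card_nsmul (Finset.range i) (f a) (B a) fun j hj =>
            hfB a j ((Finset.mem_range.1 hj).trans_le hi)
      _ ≤ n a * B a := Nat.mul_le_mul_right _ hi

theorem mod_succ_le (m p : ℕ) : m % (p + 1) ≤ p :=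
  Nat.lt_succ_iff.1 (Nat.mod_lt m p.succ_pos)

@[fun_prop]
theorem prod_mod {p : α → ℕ} {f : α → ℕ → ℕ} (hn : PolyTime n) (hp : PolyTime p)
    (hf : PolyTime fun x : α × ℕ => f x.1 x.2) :
    PolyTime fun a => (∏ i ∈ Finset.range (n a), f a i) % (p a + 1) := by
  have hf' : PolyTime fun x : α × ℕ × ℕ => f x.1 x.2.1 :=
    hf.comp (f := fun x : α × ℕ × ℕ => (x.1, x.2.1)) (by fun_prop)
  exact of_recurrence (u := fun a i => (∏ j ∈ Finset.range i, f a j) % (p a + 1))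
    (F := fun a i v => v * f a i % (p a + 1)) hn (by simpa using (by fun_prop))
    ((by fun_prop : PolyTime fun x : α × ℕ × ℕ => x.2.2).mul hf' |>.mod (by fun_prop))
    (fun a i _ => by rw [Finset.prod_range_succ, Nat.mod_mul_mod]) hp.polyBounded
    fun a i _ => mod_succ_le _ _

@[fun_prop]
theorem pow_mod {p : α → ℕ} (hf : PolyTime f) (hn : PolyTime n) (hp : PolyTime p) :
    PolyTime fun a => f a ^ n a % (p a + 1) :=
  (prod_mod (f := fun a _ => f a) hn hp (by fun_prop)).of_eq fun a => by simp

theorem two_pow (hn : PolyTime n) (hpow : PolyBounded fun a => 2 ^ n a) :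
    PolyTime fun a => 2 ^ n a :=
  of_recurrence (u := fun _ i => 2 ^ i) (F := fun _ _ v => v + v) hn (.const 1) (by fun_prop)
    (fun _ i _ => (Nat.pow_succ' ..).trans (Nat.two_mul _)) hpow
    fun _ _ hi => Nat.pow_le_pow_right two_pos hi

@[fun_prop]
theorem div_two (hf : PolyTime f) : PolyTime fun a => f a / 2 := by
  have hsum (m : ℕ) : ∑ i ∈ Finset.range m, i % 2 = m / 2 := by
    induction m with
    | zero => rfl
    | succ m ih =>
      rw [Finset.sum_range_succ, ih]
      omega
  exact (hf.sum (f := fun _ i => i % 2) (by fun_prop)).of_eq fun a => hsum (f a)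

@[fun_prop]
theorem div_two_pow (hf : PolyTime f) (hn : PolyTime n) : PolyTime fun a => f a / 2 ^ n a :=
  of_recurrence (u := fun a i => f a / 2 ^ i) (F := fun _ _ v => v / 2) hn
    (by simpa using hf) (by fun_prop) (fun a i _ => by rw [pow_succ, Nat.div_div_eq_div_mul])
    hf.polyBounded fun a i _ => Nat.div_le_self _ _

@[fun_prop]
theorem testBit (hf : PolyTime f) (hn : PolyTime n) : PolyTime fun a => (f a).testBit (n a) :=
  (by fun_prop : PolyTime fun a => decide (f a / 2 ^ n a % 2 = 1)).of_eq fun a =>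
    Nat.testBit_eq_decide_div_mod_eq.symm

theorem sum_range_eq_natSize (m : ℕ) :
    (∑ i ∈ Finset.range m, if m / 2 ^ i = 0 then 0 else 1) = m.size := by
  have hfilter : {i ∈ Finset.range m | ¬m / 2 ^ i = 0} = Finset.range m.size := by
    ext i
    have hi : 2 ^ i ≤ m → i < m := i.lt_two_pow_self.trans_le
    simpa [Nat.lt_size] using hi
  rw [← Finset.card_range m.size, ← hfilter, Finset.card_filter]
  simp only [ite_not]

@[fun_prop]
theorem natSize (hf : PolyTime f) : PolyTime fun a => (f a).size :=
  (hf.sum (f := fun a i => if f a / 2 ^ i = 0 then 0 else 1) (by fun_prop)).of_eq fun a =>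
    sum_range_eq_natSize (f a)

section Decidable

variable {P : α → ℕ → Prop} [∀ a, DecidablePred (P a)]

@[fun_prop]
theorem decide_forall_lt [∀ a, Decidable (∀ i < n a, P a i)] (hn : PolyTime n)
    (hP : PolyTime fun x : α × ℕ => decide (P x.1 x.2)) :
    PolyTime fun a => decide (∀ i < n a, P a i) :=
  (decide_eq (hn.sum (f := fun a i => if P a i then 0 else 1) (hP.ite (.const 0) (.const 1)))
    (.const 0)).of_eq fun a => by simp [Finset.sum_eq_zero_iff]

@[fun_prop]
theorem decide_exists_lt [∀ a, Decidable (∃ i < n a, P a i)] (hn : PolyTime n)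
    (hP : PolyTime fun x : α × ℕ => decide (P x.1 x.2)) :
    PolyTime fun a => decide (∃ i < n a, P a i) :=
  (hn.decide_forall_lt (P := fun a i => ¬P a i) hP.decide_not).decide_not.of_eq fun a => by simp

@[fun_prop]
theorem findGreatest (hn : PolyTime n) (hP : PolyTime fun x : α × ℕ => decide (P x.1 x.2)) :
    PolyTime fun a => Nat.findGreatest (P a) (n a) :=
  of_recurrence (u := fun a i => Nat.findGreatest (P a) i)
    (F := fun a i v => if P a (i + 1) then i + 1 else v) hn (.const 0)
    (ite (hP.comp (f := fun x : α × ℕ × ℕ => (x.1, x.2.1 + 1)) (by fun_prop)) (by fun_prop)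
      (by fun_prop))
    (fun a i _ => Nat.findGreatest_succ i) hn.polyBounded
    fun a i hi => (Nat.findGreatest_le i).trans hi

@[fun_prop]
theorem count (hn : PolyTime n) (hP : PolyTime fun x : α × ℕ => decide (P x.1 x.2)) :
    PolyTime fun a => Nat.count (P a) (n a) :=
  (hn.sum (f := fun a i => if P a i then 1 else 0) (hP.ite (.const 1) (.const 0))).of_eq fun a => by
    rw [Nat.count_eq_card_filter_range, Finset.card_filter]

end Decidable

@[fun_prop]
theorem decide_prime (hf : PolyTime f) : PolyTime fun a => decide (f a).Prime :=
  (by fun_prop : PolyTime fun a => decide (2 ≤ f a ∧ ∀ m < f a, ¬(2 ≤ m ∧ f a % m = 0))).of_eq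
    fun a => by
      rw [decide_eq_decide, Nat.prime_def_lt']
      simp only [not_and, Nat.dvd_iff_mod_eq_zero]
      exact and_congr_right fun _ => forall_congr' fun m => forall_comm

end Arithmetic

/-! ### Lists in polynomial time -/

theorem getD {l : α → List β} {n : α → ℕ} {d : β} (hd : code d = .nil) (hl : PolyTime l)
    (hn : PolyTime n) : PolyTime fun a => (l a).getD (n a) d := by
  have hdrop : PolyTime fun a => (l a).drop (n a) :=
    of_recurrence (u := fun a i => (l a).drop i) (F := fun _ _ v => v.tail) hn hl (by fun_prop)
      (fun a i _ => List.tail_drop.symm) hl.polyBounded fun a i _ => size_drop_le _ _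
  exact (hdrop.headD hd).of_eq fun a => by
    rw [List.headD_eq_head?_getD, List.head?_drop, List.getD_eq_getElem?_getD]

@[fun_prop]
theorem getD_zero {l : α → List ℕ} {n : α → ℕ} (hl : PolyTime l) (hn : PolyTime n) :
    PolyTime fun a => (l a).getD (n a) 0 :=
  getD rfl hl hn

@[fun_prop]
theorem getD_false {l : α → List Bool} {n : α → ℕ} (hl : PolyTime l) (hn : PolyTime n) :
    PolyTime fun a => (l a).getD (n a) false :=
  getD rfl hl hn

@[fun_prop]
theorem getD_nil {l : α → List (List β)} {n : α → ℕ} (hl : PolyTime l) (hn : PolyTime n) :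
    PolyTime fun a => (l a).getD (n a) [] :=
  getD rfl hl hn

@[fun_prop]
theorem length {l : α → List β} (hl : PolyTime l) : PolyTime fun a => (l a).length := by
  have hloop : PolyTime fun a => ((l a).drop (l a).length, (l a).length) :=
    of_loop (w := fun a i => ((l a).drop i, i)) (n := fun a => (l a).length)
      (test := fun x => x.1) (step := fun x => (x.1.tail, x.2 + 1)) (by simpa using by fun_prop)
      (by fun_prop) (by fun_prop) (hl.polyBounded.mono fun a => length_le_size _)
      (hl.polyBounded.add hl.polyBounded)
      (fun a i hi => Nat.add_le_add (size_drop_le _ _) (hi.trans (length_le_size _)))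
      (fun a i _ => by simp) (fun a i hi => by rw [List.drop_eq_getElem_cons hi]; nofun)
      (fun a => by rw [List.drop_length]; rfl)
  exact hloop.snd

@[fun_prop]
theorem map_range {n : α → ℕ} {f : α → ℕ → β} (hn : PolyTime n)
    (hf : PolyTime fun x : α × ℕ => f x.1 x.2) :
    PolyTime fun a => (List.range (n a)).map (f a) := by
  obtain ⟨B, hB, hfB⟩ := exists_forall_lt_size_le hn hf
  have hmap : PolyTime fun a => (List.range' (n a - n a) (n a)).map (f a) := by
    refine of_recurrence (u := fun a i => (List.range' (n a - i) i).map (f a))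
      (F := fun a i v => f a (n a - (i + 1)) :: v) hn (.const []) ?_ (fun a i hi => ?_)
      (hn.polyBounded.mul (hB.add (.const 1))) fun a i hi => ?_
    · exact (hf.comp (f := fun x : α × ℕ × List β => (x.1, n x.1 - (x.2.1 + 1)))
        (by fun_prop)).cons (by fun_prop)
    · rw [List.range'_succ, List.map_cons, Nat.sub_add_eq, Nat.sub_add_cancel (by omega)]
    · refine (size_map_le fun j hj => hfB a j ?_).trans ?_
      · rw [List.mem_range'_1] at hj
        omega
      · rw [List.length_range']
        exact Nat.mul_le_mul_right _ hi
  exact hmap.of_eq fun a => by rw [Nat.sub_self, List.range_eq_range']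

end PolyTime

/-! ### The algorithm -/

/-- An adjacency matrix as the program sees it: the list of its rows. -/
abbrev BoolMat := List (List Bool)

namespace BoolMat

/-- The entry of an adjacency matrix; `false` outside the range. -/
def adjAt (A : BoolMat) (i j : ℕ) : Bool := (A.getD i []).getD j false

/-- The indicator of the vertices that belong to the set with indicator `l` or have a neighbor
there. -/
def reachStep (A : BoolMat) (l : List Bool) : List Bool :=
  (List.range A.length).map fun v =>
    decide (l.getD v false = true ∨ ∃ u < A.length, l.getD u false = true ∧ A.adjAt u v = true)

/-- The vertex `w` can be reached from the vertex `v`, as the program decides it. -/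
def IsReachable (A : BoolMat) (v w : ℕ) : Prop :=
  (A.reachStep^[A.length] ((List.range A.length).map fun u => decide (u = v))).getD w false = true

instance (A : BoolMat) (v : ℕ) : DecidablePred (A.IsReachable v) := fun _ =>
  inferInstanceAs (Decidable (_ = true))

/-- The least vertex that can be reached from `v`; it represents the component of `v`. -/
def rep (A : BoolMat) (v : ℕ) : ℕ := Nat.findGreatest (fun i => ∀ j < i, ¬A.IsReachable v j) v

/-- The vertex `v` represents its component. -/
def IsRep (A : BoolMat) (v : ℕ) : Prop := A.rep v = v

instance (A : BoolMat) : DecidablePred A.IsRep := fun v => inferInstanceAs (Decidable (A.rep v = v))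

/-- The number of components. -/
def compCount (A : BoolMat) : ℕ := Nat.count A.IsRep A.length

/-- The position of the component of `v` when components are ordered by their representatives. -/
def compIndex (A : BoolMat) (v : ℕ) : ℕ := Nat.count A.IsRep (A.rep v)

end BoolMat

/-- A square matrix of natural numbers: the list of its rows. -/
abbrev NatMat := List (List ℕ)

namespace NatMat

/-- The entry of a matrix; `0` outside the range. -/
def entry (M : NatMat) (i j : ℕ) : ℕ := (M.getD i []).getD j 0

/-- The `n` by `n` matrix with the given entries. -/
def ofFn (n : ℕ) (f : ℕ → ℕ → ℕ) : NatMat :=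
  (List.range n).map fun i => (List.range n).map fun j => f i j

/-- One step of Bird's algorithm modulo `p + 1`, where `p` plays the role of `-1`. -/
def birdStepMod (p n : ℕ) (M X : NatMat) : NatMat :=
  ofFn n fun i j => ((∑ r ∈ Finset.range n, if i < r then X.entry r r else 0) * M.entry i j
    + p * ∑ r ∈ Finset.range n, if i < r then X.entry i r * M.entry r j else 0) % (p + 1)

/-- The determinant modulo `p + 1`, computed without divisions by Bird's algorithm. -/
def detMod (p n : ℕ) (M : NatMat) : ℕ := ((birdStepMod p n M)^[n - 1] M).entry 0 0 % (p + 1)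

end NatMat

/-- A table of numbers indexed by an arc of the pattern and an arc of the host. -/
abbrev ArcTable := List (List NatMat)

/-- The entry of a table for the arc from `a` to `x` of the pattern and the arc from `v` to `w` of
the host; `0` outside the range. -/
def ArcTable.entry (T : ArcTable) (a x v w : ℕ) : ℕ :=
  NatMat.entry ((T.getD a []).getD x []) v w

/-- The input of the algorithm: the adjacency matrices of the pattern and of the host. -/
structure Input where
  matH : BoolMat
  matG : BoolMat

namespace Input

/-- The number of vertices of the pattern. -/
def h (I : Input) : ℕ := I.matH.length

/-- The number of vertices of the host. -/
def g (I : Input) : ℕ := I.matG.length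

/-- The number of sets of components of the pattern. -/
def sets (I : Input) : ℕ := 2 ^ I.matH.compCount

/-- A strict upper bound for twice the degree of the polynomial that is tested. -/
def degBound (I : Input) : ℕ := 2 * ((I.g + (I.h + 1) + 1) * I.g) + 1

/-- The number of coins that are tossed for each random number. -/
def width (I : Input) : ℕ := I.degBound.size

/-- The number `p - 1` for the prime number `p` modulo which the algorithm calculates. -/
def primePred (I : Input) : ℕ := Nat.findGreatest (fun q => (q + 1).Prime) (2 * 2 ^ I.width)

/-- The number of coins that are tossed. -/
def coins (I : Input) : ℕ := (I.h + 1) * I.g * I.width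

/-- The random number for the vertex `x` of the pattern and the vertex `w` of the host, where the
index `x = h` stands for an additional isolated vertex. -/
def point (I : Input) (r : List Bool) (x w : ℕ) : ℕ :=
  (∑ i ∈ Finset.range I.width, if r.getD ((x * I.g + w) * I.width + i) false = true then
    2 ^ i % (I.primePred + 1) else 0) % (I.primePred + 1)

/-- The random numbers, replaced by zero outside the components whose indices are the bits of `t`
and the additional vertex. -/
def rootPoint (I : Input) (r : List Bool) (t x w : ℕ) : ℕ :=
  if x = I.h ∨ t.testBit (I.matH.compIndex x) = true then I.point r x w else 0

/-- The vertex `y` follows the arc from `a` to `x` in the pattern. -/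
def SuccH (I : Input) (a x y : ℕ) : Prop := I.matH.adjAt x y = true ∧ y ≠ a

/-- The vertex `i` follows the arc from `v` to `w` in the host. -/
def SuccG (I : Input) (v w i : ℕ) : Prop := I.matG.adjAt w i = true ∧ i ≠ v

instance (I : Input) (a x y : ℕ) : Decidable (I.SuccH a x y) := inferInstanceAs (Decidable (_ ∧ _))

instance (I : Input) (v w i : ℕ) : Decidable (I.SuccG v w i) := inferInstanceAs (Decidable (_ ∧ _))

/-- The value of the branch behind the arc from `v` to `w` of the host when no vertex of the pattern
has to be placed at `w`. -/
def freeValue (I : Input) (r : List Bool) (t : ℕ) (T : ArcTable) (v w : ℕ) : ℕ :=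
  (∑ x ∈ Finset.range (I.h + 1), I.rootPoint r t x w * T.entry x x v w) % (I.primePred + 1)

/-- The entries of the matrix whose determinant is the value for the arc from `a` to `x` of the
pattern and the arc from `v` to `w` of the host. Indices below `g` are vertices of the host, the
others are vertices of the pattern shifted by `g`. -/
def matchEntry (I : Input) (r : List Bool) (t : ℕ) (T : ArcTable) (a x v w i j : ℕ) : ℕ :=
  if i < I.g then
    if j < I.g then
      if i = j then (if I.SuccG v w i then I.freeValue r t T w i else 1) else 0
    else
      if I.SuccG v w i ∧ I.SuccH a x (j - I.g) then
        I.point r (j - I.g) i * T.entry x (j - I.g) w i else 0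
  else
    if j < I.g then
      if I.SuccG v w j ∧ I.SuccH a x (i - I.g) then I.point r (i - I.g) j else 0
    else
      if i = j then (if I.SuccH a x (i - I.g) then 0 else 1) else 0

/-- The table of the values of longer branches, given the table for shorter ones. -/
def tableStep (I : Input) (r : List Bool) (t : ℕ) (T : ArcTable) : ArcTable :=
  (List.range (I.h + 1)).map fun a => (List.range (I.h + 1)).map fun x =>
    NatMat.ofFn I.g fun v w => NatMat.detMod I.primePred (I.g + (I.h + 1))
      (NatMat.ofFn (I.g + (I.h + 1)) fun i j => I.matchEntry r t T a x v w i j)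

/-- The table of the values of all arcs. -/
def valueTable (I : Input) (r : List Bool) (t : ℕ) : ArcTable := (I.tableStep r t)^[I.g] []

/-- The product of the values of the components of the host. -/
def total (I : Input) (r : List Bool) (t : ℕ) : ℕ :=
  (∏ w ∈ Finset.range I.g, if I.matG.IsRep w then I.freeValue r t (I.valueTable r t) w w else 1)
    % (I.primePred + 1)

/-- The sign of the set of components whose indices are the bits of `t`. -/
def sign (I : Input) (t : ℕ) : ℕ :=
  (∏ j ∈ Finset.range I.matH.compCount, if t.testBit j = true then 1 else I.primePred)
    % (I.primePred + 1)

/-- The alternating sum over all sets of components. -/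
def result (I : Input) (r : List Bool) : ℕ :=
  (∑ t ∈ Finset.range I.sets, I.sign t * I.total r t) % (I.primePred + 1)

/-- The number of sets of components contributes to the size, so that computations which run through
these sets take polynomial time. -/
instance : Coded Input := ⟨fun I => .cons (code I.matH) (code I.matG),
  fun I => I.sets + (size I.matH + size I.matG)⟩

end Input

/-! ### The algorithm takes polynomial time -/

namespace PolyTime

variable {α β : Type} [Coded α] [Coded β]

section Matrices

variable {A : α → BoolMat} {M X : α → NatMat} {T : α → ArcTable} {n p i j v w : α → ℕ}

@[fun_prop]
theorem adjAt (hA : PolyTime A) (hi : PolyTime i) (hj : PolyTime j) :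
    PolyTime fun a => (A a).adjAt (i a) (j a) := by
  unfold BoolMat.adjAt
  fun_prop

theorem size_map_range_le {n S : ℕ} {f : ℕ → β} (h : ∀ i, size (f i) ≤ S) :
    size ((List.range n).map f) ≤ n * (S + 1) :=
  (size_map_le fun i _ => h i).trans (by rw [List.length_range])

@[fun_prop]
theorem decide_isReachable (hA : PolyTime A) (hv : PolyTime v) (hw : PolyTime w) :
    PolyTime fun a => decide ((A a).IsReachable (v a) (w a)) := by
  have hstep : PolyTime fun x : α × List Bool => (A x.1).reachStep x.2 := by
    unfold BoolMat.reachStep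
    fun_prop
  have hlist : PolyTime fun a => (A a).reachStep^[(A a).length]
      ((List.range (A a).length).map fun u => decide (u = v a)) :=
    iterate (by fun_prop) (by fun_prop) hstep (PolyTime.polyBounded (f := fun a => (A a).length)
      (by fun_prop)) fun a l =>
        (size_map_range_le (S := 0) fun _ => le_rfl).trans (Nat.mul_one _).le
  exact (hlist.getD_false hw).decide_bool

@[fun_prop]
theorem rep (hA : PolyTime A) (hv : PolyTime v) : PolyTime fun a => (A a).rep (v a) := by
  unfold BoolMat.rep
  fun_prop

@[fun_prop]
theorem decide_isRep (hA : PolyTime A) (hv : PolyTime v) :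
    PolyTime fun a => decide ((A a).IsRep (v a)) :=
  (hA.rep hv).decide_eq hv

@[fun_prop]
theorem compCount (hA : PolyTime A) : PolyTime fun a => (A a).compCount := by
  unfold BoolMat.compCount
  fun_prop

@[fun_prop]
theorem compIndex (hA : PolyTime A) (hv : PolyTime v) :
    PolyTime fun a => (A a).compIndex (v a) := by
  unfold BoolMat.compIndex
  fun_prop

@[fun_prop]
theorem natMat_entry (hM : PolyTime M) (hi : PolyTime i) (hj : PolyTime j) :
    PolyTime fun a => (M a).entry (i a) (j a) := by
  unfold NatMat.entry
  fun_prop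

@[fun_prop]
theorem natMat_ofFn {f : α → ℕ → ℕ → ℕ} (hn : PolyTime n)
    (hf : PolyTime fun x : (α × ℕ) × ℕ => f x.1.1 x.1.2 x.2) :
    PolyTime fun a => NatMat.ofFn (n a) (f a) :=
  map_range hn (map_range (f := fun (x : α × ℕ) j => f x.1 x.2 j) (by fun_prop) hf)

@[fun_prop]
theorem birdStepMod (hp : PolyTime p) (hn : PolyTime n) (hM : PolyTime M) (hX : PolyTime X) :
    PolyTime fun a => NatMat.birdStepMod (p a) (n a) (M a) (X a) := by
  unfold NatMat.birdStepMod
  fun_prop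

@[fun_prop]
theorem detMod (hp : PolyTime p) (hn : PolyTime n) (hM : PolyTime M) :
    PolyTime fun a => NatMat.detMod (p a) (n a) (M a) := by
  have hiter : PolyTime fun a => (NatMat.birdStepMod (p a) (n a) (M a))^[n a - 1] (M a) :=
    iterate (by fun_prop) hM (by fun_prop)
      (polyBounded (f := fun a => n a * (n a * (p a + 1) + 1)) (by fun_prop))
      fun a X => size_map_range_le fun i => size_map_range_le fun j => mod_succ_le _ _
  unfold NatMat.detMod
  fun_prop

@[fun_prop]
theorem arcTable_entry (hT : PolyTime T) (hi : PolyTime i) (hj : PolyTime j) (hv : PolyTime v)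
    (hw : PolyTime w) : PolyTime fun a => (T a).entry (i a) (j a) (v a) (w a) := by
  unfold ArcTable.entry
  fun_prop

end Matrices

theorem two_pow_natSize_le (m : ℕ) : 2 ^ m.size ≤ 2 * m + 1 := by
  cases hs : m.size with
  | zero => exact Nat.le_add_left 1 _
  | succ s =>
    have : 2 ^ s ≤ m := Nat.lt_size.1 (by omega)
    rw [pow_succ]
    omega

section Input

variable {I : α → Input} {r : α → List Bool} {T : α → ArcTable} {t a x v w i j : α → ℕ}

@[fun_prop]
theorem matH (hI : PolyTime I) : PolyTime fun a => (I a).matH := by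
  have hmatH : PolyTime Input.matH :=
    ⟨.fst, fun _ => 1, .const 1, PolyBounded.size.mono fun I =>
      (Nat.le_add_right _ _).trans (Nat.le_add_left _ _), fun _ => ⟨1, le_rfl, fun _ => .fst _ _⟩⟩
  exact hmatH.comp hI

@[fun_prop]
theorem matG (hI : PolyTime I) : PolyTime fun a => (I a).matG := by
  have hmatG : PolyTime Input.matG :=
    ⟨.snd, fun _ => 1, .const 1, PolyBounded.size.mono fun I =>
      (Nat.le_add_left _ _).trans (Nat.le_add_left _ _), fun _ => ⟨1, le_rfl, fun _ => .snd _ _⟩⟩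
  exact hmatG.comp hI

@[fun_prop]
theorem inputH (hI : PolyTime I) : PolyTime fun a => (I a).h := by
  unfold Input.h
  fun_prop

@[fun_prop]
theorem inputG (hI : PolyTime I) : PolyTime fun a => (I a).g := by
  unfold Input.g
  fun_prop

@[fun_prop]
theorem sets (hI : PolyTime I) : PolyTime fun a => (I a).sets := by
  have hsets : PolyTime Input.sets := two_pow (by fun_prop) <|
    PolyBounded.size.mono fun I => Nat.le_add_right I.sets _
  exact hsets.comp hI

@[fun_prop]
theorem degBound (hI : PolyTime I) : PolyTime fun a => (I a).degBound := by
  unfold Input.degBound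
  fun_prop

@[fun_prop]
theorem width (hI : PolyTime I) : PolyTime fun a => (I a).width := by
  unfold Input.width
  fun_prop

@[fun_prop]
theorem primePred (hI : PolyTime I) : PolyTime fun a => (I a).primePred := by
  have hpow : PolyTime fun a => 2 ^ (I a).width := hI.width.two_pow <|
    (polyBounded (f := fun a => 2 * (I a).degBound + 1) (by fun_prop)).mono fun a =>
      two_pow_natSize_le _
  unfold Input.primePred
  fun_prop

@[fun_prop]
theorem coins (hI : PolyTime I) : PolyTime fun a => (I a).coins := by
  unfold Input.coins
  fun_prop

@[fun_prop]
theorem point (hI : PolyTime I) (hr : PolyTime r) (hx : PolyTime x) (hw : PolyTime w) :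
    PolyTime fun a => (I a).point (r a) (x a) (w a) := by
  unfold Input.point
  fun_prop

@[fun_prop]
theorem rootPoint (hI : PolyTime I) (hr : PolyTime r) (ht : PolyTime t) (hx : PolyTime x)
    (hw : PolyTime w) : PolyTime fun a => (I a).rootPoint (r a) (t a) (x a) (w a) := by
  unfold Input.rootPoint
  fun_prop

@[fun_prop]
theorem freeValue (hI : PolyTime I) (hr : PolyTime r) (ht : PolyTime t) (hT : PolyTime T)
    (hv : PolyTime v) (hw : PolyTime w) :
    PolyTime fun a => (I a).freeValue (r a) (t a) (T a) (v a) (w a) := by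
  unfold Input.freeValue
  fun_prop

@[fun_prop]
theorem matchEntry (hI : PolyTime I) (hr : PolyTime r) (ht : PolyTime t) (hT : PolyTime T)
    (ha : PolyTime a) (hx : PolyTime x) (hv : PolyTime v) (hw : PolyTime w) (hi : PolyTime i)
    (hj : PolyTime j) : PolyTime fun b =>
      (I b).matchEntry (r b) (t b) (T b) (a b) (x b) (v b) (w b) (i b) (j b) := by
  unfold Input.matchEntry Input.SuccG Input.SuccH
  fun_prop

@[fun_prop]
theorem tableStep (hI : PolyTime I) (hr : PolyTime r) (ht : PolyTime t) (hT : PolyTime T) :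
    PolyTime fun a => (I a).tableStep (r a) (t a) (T a) := by
  unfold Input.tableStep
  fun_prop

@[fun_prop]
theorem valueTable (hI : PolyTime I) (hr : PolyTime r) (ht : PolyTime t) :
    PolyTime fun a => (I a).valueTable (r a) (t a) :=
  iterate (by fun_prop) (by fun_prop) (by fun_prop)
    (polyBounded (f := fun a => ((I a).h + 1) * (((I a).h + 1) *
      ((I a).g * ((I a).g * ((I a).primePred + 1) + 1) + 1) + 1)) (by fun_prop))
    fun a T => size_map_range_le fun _ => size_map_range_le fun _ => size_map_range_le fun _ =>
      size_map_range_le fun _ => mod_succ_le _ _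

@[fun_prop]
theorem total (hI : PolyTime I) (hr : PolyTime r) (ht : PolyTime t) :
    PolyTime fun a => (I a).total (r a) (t a) := by
  unfold Input.total
  fun_prop

@[fun_prop]
theorem sign (hI : PolyTime I) (ht : PolyTime t) : PolyTime fun a => (I a).sign (t a) := by
  unfold Input.sign
  fun_prop

theorem result (hI : PolyTime I) (hr : PolyTime r) : PolyTime fun a => (I a).result (r a) := by
  unfold Input.result
  fun_prop

end Input

/-! ### Coin tosses -/

/-- On states `(a, m, s)`, tosses `m` coins and collects the outcomes in front of `s`. -/
def tossLoop : Prog :=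
  .loop (.seq .snd .fst)
    (.pair .fst (.pair (.seq .snd (.seq .fst .snd)) (.pair .flip (.seq .snd .snd))))

theorem eval_tossLoop (a : α) (m : ℕ) (s r : List Bool) (hr : m ≤ r.length) :
    Eval tossLoop (code (a, m, s)) r (code (a, 0, (r.take m).reverse ++ s)) (r.drop m)
      (m * 17 + 4) := by
  induction m generalizing s r with
  | zero => exact .loop_done (.seq (.snd ..) (.fst ..))
  | succ m ih =>
    cases r with
    | nil => simp at hr
    | cons c r =>
      have rest := ih (c :: s) r (by simpa using hr)
      have step : Eval (.pair .fst (.pair (.seq .snd (.seq .fst .snd)) (.pair .flip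
          (.seq .snd .snd)))) (code (a, m + 1, s)) (c :: r) (code (a, m, c :: s)) r 13 :=
        .pair (.fst ..) <| .pair (.seq (.snd ..) (.seq (.fst ..) (.snd ..))) <|
          .pair (.flip ..) (.seq (.snd ..) (.snd ..))
      rw [List.take_succ_cons, List.reverse_cons, List.append_assoc,
        show (m + 1) * 17 + 4 = 1 + 1 + 1 + 13 + (m * 17 + 4) + 1 by omega]
      exact .loop_step (v := code (m + 1)) (.seq (.snd ..) (.fst ..)) nofun step rest

theorem exists_eval_toss {n : α → ℕ} {f : α × List Bool → Bool} (hn : PolyTime n)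
    (hf : PolyTime f) : ∃ (p : Prog) (T : α → ℕ), PolyBounded T ∧ (∀ a, n a ≤ T a) ∧
      ∀ a (r : List Bool), n a ≤ r.length → ∃ t ≤ T a, Eval p (code a) r
        (.ofBool (f (a, (r.take (n a)).reverse))) (r.drop (n a)) t := by
  have start : PolyTime fun a => (a, n a, ([] : List Bool)) := by fun_prop
  have forget : PolyTime fun x : α × ℕ × List Bool => f (x.1, x.2.2) := by fun_prop
  obtain ⟨p, S, hS, -, hp⟩ := start
  obtain ⟨q, T, hT, -, hq⟩ := forget
  obtain ⟨T', hT', hTT'⟩ :=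
    hT.exists_forall_le_of_size_le (PolyBounded.size.add hn.polyBounded)
  refine ⟨(p.seq tossLoop).seq q, fun a => S a + n a * 17 + T' a + 6,
    ((hS.add (hn.polyBounded.mul (.const 17))).add hT').add (.const 6),
    fun a => by dsimp only; omega, fun a r hr => ?_⟩
  obtain ⟨s, hs, hp⟩ := hp a
  obtain ⟨t, ht, hq⟩ := hq (a, 0, (r.take (n a)).reverse)
  have htT' : t ≤ T' a := ht.trans (hTT' a _ (by simp [size_list_bool]))
  have toss := eval_tossLoop a (n a) [] r hr
  rw [List.append_nil] at toss
  exact ⟨s + (n a * 17 + 4) + 1 + t + 1, by dsimp only; omega, .seq (.seq (hp r) toss) (hq _)⟩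

end PolyTime

/-! ### Branches of a graph -/

section Branch

open Relation

variable {V : Type*} {G : SimpleGraph V} {a b c x y y' z : V} {n d : ℕ}

/-- The vertex `y` can be reached from `x` by a walk that does not step on `a`. If `a` is a neighbor
of `x` in a forest, this is the subtree behind the arc from `a` to `x`; for `a = x` it is the whole
component of `x`. -/
def Branch (G : SimpleGraph V) (a x y : V) : Prop :=
  ReflTransGen (fun u v => G.Adj u v ∧ v ≠ a) x y

/-- No neighbor of `x` can be reached from another one without passing through `x`. -/
def NoReturn (G : SimpleGraph V) (x : V) : Prop :=
  ∀ y z, G.Adj x y → G.Adj x z → y ≠ z → ¬Branch G x y z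

namespace Branch

theorem refl (a x : V) : Branch G a x x := ReflTransGen.refl

theorem trans (h : Branch G a x y) (h' : Branch G a y z) : Branch G a x z := ReflTransGen.trans h h'

theorem ne (h : Branch G a x y) (hx : x ≠ a) : y ≠ a := by
  cases h with
  | refl => exact hx
  | tail _ h => exact h.2

theorem step (h : Branch G a x y) (hyz : G.Adj y z) (hz : z ≠ a) : Branch G a x z :=
  ReflTransGen.tail h ⟨hyz, hz⟩

theorem symm (h : Branch G a x y) (hx : x ≠ a) : Branch G a y x := by
  induction h with
  | refl => exact refl _ _
  | tail h huv ih => exact ReflTransGen.head ⟨huv.1.symm, ne h hx⟩ ih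

theorem eq_or_exists_adj (h : Branch G a x y) :
    y = x ∨ ∃ z, (G.Adj x z ∧ z ≠ a) ∧ Branch G x z y := by
  induction h with
  | refl => exact .inl rfl
  | @tail y z _ hyz ih =>
    rcases eq_or_ne z x with hz | hz
    · exact .inl hz
    rcases ih with rfl | ⟨u, hu, huy⟩
    · exact .inr ⟨z, hyz, refl _ _⟩
    · exact .inr ⟨u, hu, huy.step hyz.1 hz⟩

theorem of_adj (hx : NoReturn G x) (ha : a = x ∨ G.Adj x a) (hy : G.Adj x y ∧ y ≠ a)
    (h : Branch G x y z) : Branch G a x z := by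
  induction h with
  | refl => exact (refl a x).step hy.1 hy.2
  | @tail u z h huz ih =>
    refine ih.step huz.1 ?_
    rintro rfl
    rcases ha with rfl | ha
    · exact huz.2 rfl
    · exact hx y z hy.1 ha hy.2 (h.tail huz)

end Branch

theorem NoReturn.eq_of_branch (hx : NoReturn G x) (hy : G.Adj x y) (hy' : G.Adj x y')
    (h : Branch G x y z) (h' : Branch G x y' z) : y = y' := by
  by_contra hne
  exact hx y y' hy hy' hne (h.trans (h'.symm hy'.ne'))

theorem branch_self_iff_reachable : Branch G x x y ↔ G.Reachable x y := by
  rw [SimpleGraph.reachable_iff_reflTransGen]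
  refine ⟨ReflTransGen.mono (fun _ _ => And.left) _ _, fun h => ?_⟩
  induction h with
  | refl => exact Branch.refl _ _
  | @tail y z _ hyz ih =>
    rcases eq_or_ne z x with rfl | hz
    · exact Branch.refl _ _
    · exact ih.step hyz hz

theorem noReturn_of_isAcyclic (hG : G.IsAcyclic) (x : V) : NoReturn G x := by
  intro y z hxy hxz hyz h
  have reach (w : V) (h : Branch G x y w) : (G.deleteEdges {s(x, y)}).Reachable w y := by
    induction h with
    | refl => exact .refl _
    | @tail u w h huw ih =>
      have hu : u ≠ x := Branch.ne h hxy.ne'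
      refine .trans (SimpleGraph.Adj.reachable ?_) ih
      simpa [SimpleGraph.deleteEdges_adj, huw.1.symm, huw.2] using fun _ => hu
  refine (SimpleGraph.isBridge_iff.1 (SimpleGraph.isAcyclic_iff_forall_adj_isBridge.1 hG hxy)) ?_
  refine .trans (SimpleGraph.Adj.reachable ?_) (reach z h)
  simpa [SimpleGraph.deleteEdges_adj, hxz, hxy.ne] using hyz.symm

/-- The tree of all walks that continue the arc from `a` to `x` and do not turn back has height
less than `d`. -/
def FinUnfold (G : SimpleGraph V) : ℕ → V → V → Prop
  | 0, _, _ => False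
  | d + 1, a, x => ∀ y, G.Adj x y → y ≠ a → FinUnfold G d x y

/-- Some walk with `n` steps that starts with the arc from `x` to `y`, does not turn back and does
not come back to `x` ends with the arc from `b` to `c`. -/
inductive NonBacktracking (G : SimpleGraph V) (x y : V) : ℕ → V → V → Prop
  | base : NonBacktracking G x y 0 x y
  | step {n : ℕ} {b c z : V} : NonBacktracking G x y n b c → G.Adj c z → z ≠ b → z ≠ x →
      NonBacktracking G x y (n + 1) c z

theorem NonBacktracking.finUnfold (h : NonBacktracking G x y n b c) (hd : FinUnfold G d x y) :
    ∃ d', d' + n = d ∧ FinUnfold G d' b c := by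
  induction h with
  | base => exact ⟨d, rfl, hd⟩
  | step _ hcz hzb _ ih =>
    obtain ⟨_ | d', hd', hbc⟩ := ih
    · exact hbc.elim
    · exact ⟨d', by omega, hbc _ hcz hzb⟩

theorem NonBacktracking.snd_ne (h : NonBacktracking G x y n b c) (hy : y ≠ x) : c ≠ x := by
  cases h <;> assumption

theorem Branch.exists_nonBacktracking (h : Branch G x y z) :
    ∃ n b, NonBacktracking G x y n b z := by
  induction h with
  | refl => exact ⟨0, x, .base⟩
  | @tail u z _ huz ih =>
    obtain ⟨n, b, h⟩ := ih
    rcases eq_or_ne z b with rfl | hz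
    · cases h with
      | base => exact absurd rfl huz.2
      | step h _ _ _ => exact ⟨_, _, h⟩
    · exact ⟨n + 1, u, h.step huz.1 hz huz.2⟩

/-- A closed walk through `y`, `z` and `x` could be continued forever without turning back. -/
theorem FinUnfold.not_branch (hd : FinUnfold G d x y) (hy : G.Adj x y) (hz : G.Adj x z)
    (hyz : y ≠ z) : ¬Branch G x y z := by
  intro hb
  obtain ⟨n, b, h⟩ := hb.exists_nonBacktracking
  have hbx : b ≠ x := by
    cases h with
    | base => exact absurd rfl hyz
    | step h _ _ _ => exact h.snd_ne hy.ne'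
  induction d using Nat.strong_induction_on with
  | _ d ih =>
    obtain ⟨_ | _ | d', hd', hbz⟩ := h.finUnfold hd
    · exact hbz
    · exact hbz x hz.symm hbx.symm
    · exact ih d' (by omega) (hbz x hz.symm hbx.symm y hy hyz)

end Branch

/-! ### The polynomial -/

section Values

variable {V W R : Type*} [Fintype V] [Fintype W] [CommRing R] {G : SimpleGraph V}
  {H : SimpleGraph W}

open Classical in
/-- The matrix whose determinant is the value of the arc from `a` to `x` at the arc from `v` to
`w`. A perfect matching of its rows and columns assigns to the further neighbors of `x` distinct
further neighbors of `w`. -/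
noncomputable def matchMatrix (G : SimpleGraph V) (H : SimpleGraph W) (z : W → V → R)
    (P : W → W → V → V → R) (Z : V → V → R) (a x : W) (v w : V) : Matrix (V ⊕ W) (V ⊕ W) R :=
  Matrix.of fun i j => match i, j with
    | .inl i, .inl j => if i = j then (if G.Adj w i ∧ i ≠ v then Z w i else 1) else 0
    | .inl i, .inr y =>
      if (G.Adj w i ∧ i ≠ v) ∧ (H.Adj x y ∧ y ≠ a) then z y i * P x y w i else 0
    | .inr y, .inl j => if (G.Adj w j ∧ j ≠ v) ∧ (H.Adj x y ∧ y ≠ a) then z y j else 0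
    | .inr y, .inr y' => if y = y' then (if H.Adj x y ∧ y ≠ a then 0 else 1) else 0

open Classical in
/-- The value of the arc from `a` to `x` at the arc from `v` to `w`, up to depth `d`: a signed sum
over the ways to embed the branch of `H` behind the former arc, together with whole components of
`H`, into the branch of `G` behind the latter. The variables `y` mark the roots of the components,
the variables `z` the other vertices of their embeddings. -/
noncomputable def arcValue (G : SimpleGraph V) (H : SimpleGraph W) (z y : W → V → R) :
    ℕ → W → W → V → V → R
  | 0 => fun _ _ _ _ => 0
  | d + 1 => fun a x v w =>
    (matchMatrix G H z (arcValue G H z y d)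
      (fun v w => ∑ x, y x w * arcValue G H z y d x x v w) a x v w).det

/-- The value of the arc from `v` to `w` when only whole components of `H` are embedded. -/
noncomputable def branchValue (G : SimpleGraph V) (H : SimpleGraph W) (z y : W → V → R) (d : ℕ)
    (v w : V) : R :=
  ∑ x, y x w * arcValue G H z y d x x v w

open Classical in
theorem arcValue_succ (z y : W → V → R) (d : ℕ) (a x : W) (v w : V) :
    arcValue G H z y (d + 1) a x v w =
      (matchMatrix G H z (arcValue G H z y d) (branchValue G H z y d) a x v w).det := rfl

variable {S : Type*} [CommRing S] (φ : R →+* S)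

theorem map_arcValue (z y : W → V → R) (d : ℕ) (a x : W) (v w : V) :
    φ (arcValue G H z y d a x v w) =
      arcValue G H (fun x w => φ (z x w)) (fun x w => φ (y x w)) d a x v w := by
  classical
  induction d generalizing a x v w with
  | zero => exact map_zero φ
  | succ d ih =>
    rw [arcValue_succ, arcValue_succ, RingHom.map_det]
    congr 1
    ext i j
    rcases i with i | i <;> rcases j with j | j <;>
      simp only [RingHom.mapMatrix_apply, Matrix.map_apply, matchMatrix, Matrix.of_apply] <;>
      split_ifs <;> simp [ih, branchValue]

theorem map_branchValue (z y : W → V → R) (d : ℕ) (v w : V) :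
    φ (branchValue G H z y d v w) =
      branchValue G H (fun x w => φ (z x w)) (fun x w => φ (y x w)) d v w := by
  simp only [branchValue, map_sum, map_mul, map_arcValue]

end Values

section BranchCard

variable {V : Type*} [Fintype V] {G : SimpleGraph V} {v w : V}

open Classical in
/-- The number of vertices of a branch. -/
noncomputable def branchCard (G : SimpleGraph V) (v w : V) : ℕ :=
  (Finset.univ.filter (Branch G v w)).card

theorem branchCard_pos : 0 < branchCard G v w :=
  Finset.card_pos.2 ⟨w, by classical exact Finset.mem_filter.2 ⟨Finset.mem_univ w, .refl v w⟩⟩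

open Classical in
theorem sum_branchCard_lt (hG : ∀ x, NoReturn G x) (hv : v = w ∨ G.Adj w v) :
    ∑ i, (if G.Adj w i ∧ i ≠ v then branchCard G w i else 0) < branchCard G v w := by
  rw [← Finset.sum_filter]
  unfold branchCard
  rw [← Finset.card_biUnion]
  · refine Finset.card_lt_card ⟨?_, fun h => ?_⟩
    · simpa [Finset.subset_iff] using fun y i hi hiv hy => Branch.of_adj (hG w) hv ⟨hi, hiv⟩ hy
    · obtain ⟨i, ⟨hi, -⟩, hw⟩ := by
        simpa using h (Finset.mem_filter.2 ⟨Finset.mem_univ w, Branch.refl v w⟩)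
      exact hw.ne hi.ne' rfl
  · intro i hi j hj hij
    rw [Function.onFun, Finset.disjoint_filter]
    simp only [Finset.coe_filter, Finset.mem_univ, true_and, Set.mem_ofPred_eq] at hi hj
    exact fun y _ hiy hjy => hij ((hG w).eq_of_branch hi.1 hj.1 hiy hjy)

theorem branchCard_lt (hG : ∀ x, NoReturn G x) {i : V} (hv : v = w ∨ G.Adj w v)
    (hi : G.Adj w i ∧ i ≠ v) : branchCard G w i < branchCard G v w := by
  classical
  refine lt_of_le_of_lt ?_ (sum_branchCard_lt hG hv)
  rw [← if_pos (c := G.Adj w i ∧ i ≠ v) (t := branchCard G w i) (e := 0) hi]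
  exact Finset.single_le_sum (f := fun i => if G.Adj w i ∧ i ≠ v then branchCard G w i else 0)
    (fun _ _ => Nat.zero_le _) (Finset.mem_univ i)

theorem sum_branchCard_le_card {s : Finset V}
    (hs : ∀ w ∈ s, ∀ w' ∈ s, G.Reachable w w' → w = w') :
    ∑ w ∈ s, branchCard G w w ≤ Fintype.card V := by
  classical
  unfold branchCard
  rw [← Finset.card_biUnion]
  · exact Finset.card_le_univ _
  · intro w hw w' hw' hne
    rw [Function.onFun, Finset.disjoint_filter]
    simp only [branch_self_iff_reachable]
    exact fun y _ hwy hwy' => hne (hs w hw w' hw' (hwy.trans hwy'.symm))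

end BranchCard

/-! ### The degree of the polynomial -/

section Degree

open MvPolynomial

theorem totalDegree_det_le {n σ R : Type*} [Fintype n] [DecidableEq n] [CommRing R]
    {M : Matrix n n (MvPolynomial σ R)} {b : n → ℕ} (h : ∀ i j, (M i j).totalDegree ≤ b i) :
    M.det.totalDegree ≤ ∑ i, b i := by
  rw [Matrix.det_apply]
  refine totalDegree_finsetSum_le fun τ _ => (totalDegree_smul_le _ _).trans ?_
  refine (totalDegree_finsetProd _ _).trans ?_
  rw [← Equiv.sum_comp τ b]
  exact Finset.sum_le_sum fun i _ => h _ _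

variable {V W σ R : Type*} [CommRing R] {G : SimpleGraph V} {H : SimpleGraph W}
  {z y : W → V → MvPolynomial σ R} {d : ℕ} {v w : V}

open Classical in
theorem totalDegree_matchMatrix_apply_le {P : W → W → V → V → MvPolynomial σ R}
    {Z : V → V → MvPolynomial σ R} {b : V → ℕ} {a x : W} (hz : ∀ x w, (z x w).totalDegree ≤ 1)
    (hP : ∀ y i, G.Adj w i ∧ i ≠ v → (P x y w i).totalDegree ≤ b i)
    (hZ : ∀ i, G.Adj w i ∧ i ≠ v → (Z w i).totalDegree ≤ b i + 1) (i j : V ⊕ W) :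
    (matchMatrix G H z P Z a x v w i j).totalDegree ≤
      Sum.elim (fun i => (if G.Adj w i ∧ i ≠ v then b i else 0) + 1) (fun _ => 1) i := by
  rcases i with i | y <;> rcases j with j | y' <;>
    simp only [matchMatrix, Matrix.of_apply, Sum.elim_inl, Sum.elim_inr]
  · split_ifs with hij hi
    · exact hZ i hi
    all_goals simp
  · split_ifs with h hi hi
    · exact (totalDegree_mul _ _).trans
        ((Nat.add_le_add (hz _ _) (hP _ _ hi)).trans (Nat.add_comm _ _).le)
    · exact absurd h.1 hi
    all_goals simp
  · split_ifs
    · exact hz _ _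
    · simp
  · split_ifs <;> simp

variable [Fintype V] [Fintype W]

theorem totalDegree_branchValue_le_of_arcValue {D : ℕ} (hy : ∀ x w, (y x w).totalDegree ≤ 1)
    (h : ∀ x, (arcValue G H z y d x x v w).totalDegree ≤ D) :
    (branchValue G H z y d v w).totalDegree ≤ D + 1 :=
  totalDegree_finsetSum_le fun x _ => (totalDegree_mul _ _).trans <|
    (Nat.add_le_add (hy x w) (h x)).trans (Nat.add_comm 1 D).le

theorem totalDegree_arcValue_le (hG : ∀ x, NoReturn G x) (hz : ∀ x w, (z x w).totalDegree ≤ 1)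
    (hy : ∀ x w, (y x w).totalDegree ≤ 1) (a x : W) (hv : v = w ∨ G.Adj w v) :
    (arcValue G H z y d a x v w).totalDegree ≤
      (Fintype.card V + Fintype.card W) * branchCard G v w := by
  classical
  induction d generalizing a x v w with
  | zero => exact (totalDegree_zero (R := R) (σ := σ)).le.trans (Nat.zero_le _)
  | succ d ih =>
    rw [arcValue_succ]
    set c := Fintype.card V + Fintype.card W
    have entry_le := totalDegree_matchMatrix_apply_le (a := a) (v := v) (H := H)
      (P := arcValue G H z y d) (Z := branchValue G H z y d)
      (b := fun i => c * branchCard G w i) hz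
      (fun y i hi => ih x y (.inr hi.1.symm))
      fun i hi => totalDegree_branchValue_le_of_arcValue hy fun x => ih x x (.inr hi.1.symm)
    calc _ ≤ _ := totalDegree_det_le entry_le
      _ = c * (∑ i, (if G.Adj w i ∧ i ≠ v then branchCard G w i else 0) + 1) := by
        simp only [Fintype.sum_sum_type, Sum.elim_inl, Sum.elim_inr, Finset.sum_add_distrib,
          Finset.sum_const, Finset.card_univ, smul_eq_mul, mul_one, mul_add, Finset.mul_sum,
          mul_ite, mul_zero, add_assoc, c]
      _ ≤ c * branchCard G v w := Nat.mul_le_mul_left _ (sum_branchCard_lt hG hv)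

theorem totalDegree_branchValue_le (hG : ∀ x, NoReturn G x)
    (hz : ∀ x w, (z x w).totalDegree ≤ 1) (hy : ∀ x w, (y x w).totalDegree ≤ 1)
    (hv : v = w ∨ G.Adj w v) : (branchValue G H z y d v w).totalDegree ≤
      (Fintype.card V + Fintype.card W) * branchCard G v w + 1 :=
  totalDegree_branchValue_le_of_arcValue hy fun x => totalDegree_arcValue_le hG hz hy x x hv

end Degree

/-! ### The polynomial does not vanish if the pattern is contained in the host -/

theorem det_eq_sign_mul_prod {n R : Type*} [Fintype n] [DecidableEq n] [CommRing R]
    {M : Matrix n n R} (σ : Equiv.Perm n)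
    (h : ∀ τ : Equiv.Perm n, (∀ i, M (τ i) i ≠ 0) → τ = σ) :
    M.det = (Equiv.Perm.sign σ : ℤ) * ∏ i, M (σ i) i := by
  rw [Matrix.det_apply', Finset.sum_eq_single_of_mem σ (Finset.mem_univ σ)]
  intro τ _ hτ
  obtain ⟨i, hi⟩ := not_forall_not.1 fun hne => hτ (h τ hne)
  exact mul_eq_zero_of_right _ (Finset.prod_eq_zero (Finset.mem_univ i) hi)

section Certificate

variable {V W K : Type*} {G : SimpleGraph V} {H : SimpleGraph W}

/-- The data of an embedding `η` of the pattern without its isolated vertex `o`; every vertex `w` of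
the host is labelled by its preimage `f w`, or by `o` if there is none. -/
structure Placement (G : SimpleGraph V) (H : SimpleGraph W) (o : W) (η : W → V) (f : V → W) :
    Prop where
  isolated : ∀ x, ¬H.Adj o x
  eq_iff : ∀ w x, x ≠ o → (f w = x ↔ η x = w)
  adj : ∀ x y, H.Adj x y → G.Adj (η x) (η y)

/-- The arc from `a` to `x` is placed on the arc from `v` to `w`. -/
def Fits (H : SimpleGraph W) (η : W → V) (f : V → W) (a x : W) (v w : V) : Prop :=
  f w = x ∧ ∀ y, H.Adj x y → (η y = v ↔ y = a)

variable {o a x y : W} {η : W → V} {f : V → W} {v w j : V}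

namespace Placement

variable (hp : Placement G H o η f)
include hp

theorem ne_left (h : H.Adj x y) : x ≠ o := fun e => hp.isolated y (e ▸ h)

theorem ne_right (h : H.Adj x y) : y ≠ o := hp.ne_left h.symm

theorem label_image (h : x ≠ o) : f (η x) = x := (hp.eq_iff _ _ h).2 rfl

theorem image_label (h : f w ≠ o) : η (f w) = w := (hp.eq_iff _ _ h).1 rfl

theorem fits_self (w : V) : Fits H η f (f w) (f w) w w := by
  refine ⟨rfl, fun y hy => ⟨fun e => ?_, fun e => absurd (e ▸ hy) H.irrefl⟩⟩
  rw [← e, hp.label_image (hp.ne_right hy)] at hy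
  exact absurd hy H.irrefl

end Placement

namespace Fits

variable (hp : Placement G H o η f) (h : Fits H η f a x v w)
include hp h

theorem image_eq (hy : H.Adj x y) : η x = w := (hp.eq_iff w x (hp.ne_left hy)).1 h.1

theorem succ (hy : H.Adj x y) : Fits H η f x y w (η y) := by
  refine ⟨hp.label_image (hp.ne_right hy), fun y' hy' => ⟨fun e => ?_, ?_⟩⟩
  · rw [← hp.label_image (hp.ne_right hy'), e, h.1]
  · rintro rfl
    exact h.image_eq hp hy

theorem adj_image (hy : H.Adj x y ∧ y ≠ a) : G.Adj w (η y) ∧ η y ≠ v :=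
  ⟨h.image_eq hp hy.1 ▸ hp.adj _ _ hy.1, fun e => hy.2 ((h.2 y hy.1).1 e)⟩

theorem root (hj : j ≠ v) (hx : ¬(H.Adj x (f j) ∧ f j ≠ a)) : Fits H η f (f j) (f j) w j := by
  refine ⟨rfl, fun y hy => ⟨fun e => ?_, fun e => absurd (e ▸ hy) H.irrefl⟩⟩
  obtain rfl : x = y := by rw [← h.1, ← e, hp.label_image (hp.ne_right hy)]
  have ha : f j = a := by_contra fun hne => hx ⟨hy.symm, hne⟩
  have hav := (h.2 a (ha ▸ hy.symm)).2 rfl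
  rw [← ha, hp.image_label (hp.ne_left hy)] at hav
  exact absurd hav hj

end Fits

open Classical in
/-- The point at which the polynomial is evaluated: the variable for `x` and `w` is `u x` if `w` is
labelled by `x`, and zero otherwise. -/
noncomputable def placePoint [Zero K] (f : V → W) (u : W → K) (x : W) (w : V) : K :=
  if f w = x then u x else 0

open Classical in
/-- The matching of the rows and columns of `matchMatrix` that is given by a placement: it exchanges
each vertex `y ≠ a` that follows `x` with its image. -/
noncomputable def placeMatching (H : SimpleGraph W) (η : W → V) (f : V → W) (a x : W) :
    V ⊕ W → V ⊕ W :=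
  Sum.elim (fun i => if H.Adj x (f i) ∧ f i ≠ a then .inr (f i) else .inl i)
    fun y => if H.Adj x y ∧ y ≠ a then .inl (η y) else .inr y

namespace Placement

variable (hp : Placement G H o η f)
include hp

theorem placeMatching_involutive (a x : W) : Function.Involutive (placeMatching H η f a x) := by
  rintro (i | y)
  · by_cases hi : H.Adj x (f i) ∧ f i ≠ a
    · simp [placeMatching, hi, hp.image_label (hp.ne_right hi.1)]
    · simp [placeMatching, hi]
  · by_cases hy : H.Adj x y ∧ y ≠ a
    · simp [placeMatching, hy, hp.label_image (hp.ne_right hy.1)]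
    · simp [placeMatching, hy]

variable [CommRing K]

theorem eq_placeMatching_inr {P : W → W → V → V → K} {Z : V → V → K} {r : V ⊕ W}
    (h : matchMatrix G H (placePoint f fun _ => 1) P Z a x v w r (.inr y) ≠ 0) :
    r = placeMatching H η f a x (.inr y) := by
  rcases r with i | y' <;>
    simp only [matchMatrix, Matrix.of_apply, placePoint, ite_mul, one_mul, zero_mul, ne_eq,
      ite_eq_right_iff, not_forall] at h
  · obtain ⟨⟨-, hy⟩, rfl, -⟩ := h
    simp [placeMatching, hy, hp.image_label (hp.ne_right hy.1)]
  · obtain ⟨rfl, h⟩ := h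
    have hy : ¬(H.Adj x y' ∧ y' ≠ a) := fun hy => h (if_pos hy)
    simp [placeMatching, hy]

omit hp in
theorem eq_inl_or_eq_placeMatching_inl {P : W → W → V → V → K} {Z : V → V → K} {r : V ⊕ W}
    (h : matchMatrix G H (placePoint f fun _ => 1) P Z a x v w r (.inl j) ≠ 0) :
    r = .inl j ∨ r = placeMatching H η f a x (.inl j) := by
  rcases r with i | y <;>
    simp only [matchMatrix, Matrix.of_apply, placePoint, ne_eq, ite_eq_right_iff, not_forall] at h
  · exact .inl (congrArg _ h.1)
  · obtain ⟨⟨-, hy⟩, rfl, -⟩ := h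
    exact .inr (by simp [placeMatching, hy])

variable [Fintype V] [Fintype W]

open Classical in
theorem det_matchMatrix (P : W → W → V → V → K) (Z : V → V → K) (h : Fits H η f a x v w) :
    (matchMatrix G H (placePoint f fun _ => 1) P Z a x v w).det =
      (Equiv.Perm.sign (hp.placeMatching_involutive a x).toPerm : ℤ) *
      ((∏ j, if H.Adj x (f j) ∧ f j ≠ a then 1 else if G.Adj w j ∧ j ≠ v then Z w j else 1) *
        ∏ y, if H.Adj x y ∧ y ≠ a then P x y w (η y) else 1) := by
  rw [det_eq_sign_mul_prod (hp.placeMatching_involutive a x).toPerm, Fintype.prod_sum_type]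
  · congr 2
    · refine Finset.prod_congr rfl fun j _ => ?_
      by_cases hj : H.Adj x (f j) ∧ f j ≠ a
      · have hwj := h.adj_image hp hj
        rw [hp.image_label (hp.ne_right hj.1)] at hwj
        simp [placeMatching, matchMatrix, placePoint, hj, hwj]
      · simp [placeMatching, matchMatrix, hj]
    · refine Finset.prod_congr rfl fun y _ => ?_
      by_cases hy : H.Adj x y ∧ y ≠ a
      · have hwy := h.adj_image hp hy
        simp [placeMatching, matchMatrix, placePoint, hy, hwy, hp.label_image (hp.ne_right hy.1)]
      · simp [placeMatching, matchMatrix, hy]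
  · intro τ hτ
    have eq_inr (y : W) := hp.eq_placeMatching_inr (hτ (.inr y))
    ext (j | y) : 1
    · refine (eq_inl_or_eq_placeMatching_inl (η := η) (hτ (.inl j))).elim (fun hj => ?_) id
      by_cases hx : H.Adj x (f j) ∧ f j ≠ a
      · have := eq_inr (f j)
        rw [placeMatching, Sum.elim_inr, if_pos hx, hp.image_label (hp.ne_right hx.1), ← hj] at this
        exact absurd (τ.injective this) (by simp)
      · simp [hj, placeMatching, hx]
    · exact eq_inr y

omit hp in
theorem branchValue_placePoint (f : V → W) (u : W → K) (z : W → V → K) (d : ℕ) (v w : V) :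
    branchValue G H z (placePoint f u) d v w =
      u (f w) * arcValue G H z (placePoint f u) d (f w) (f w) v w := by
  classical
  simp [branchValue, placePoint]

/-- Every factor of the only nonzero term of each determinant is a unit. -/
theorem isUnit_arcValue (hG : ∀ x, NoReturn G x) {u : W → K} (hu : ∀ x, IsUnit (u x)) {d : ℕ}
    (h : Fits H η f a x v w) (hv : v = w ∨ G.Adj w v) (hd : branchCard G v w ≤ d) :
    IsUnit (arcValue G H (placePoint f fun _ => 1) (placePoint f u) d a x v w) := by
  classical
  induction d generalizing a x v w with
  | zero => exact absurd branchCard_pos hd.not_gt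
  | succ d ih =>
    have card_le {i : V} (hi : G.Adj w i ∧ i ≠ v) : branchCard G w i ≤ d :=
      Nat.le_of_lt_succ ((branchCard_lt hG hv hi).trans_le hd)
    rw [arcValue_succ, hp.det_matchMatrix _ _ h]
    refine .mul ((Units.isUnit _).map (Int.castRingHom K)) (.mul ?_ ?_) <;>
      rw [IsUnit.prod_univ_iff]
    · intro j
      split_ifs with hx hj
      · exact isUnit_one
      · rw [branchValue_placePoint]
        exact (hu _).mul (ih (h.root hp hj.2 hx) (.inr hj.1.symm) (card_le hj))
      · exact isUnit_one
    · intro y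
      split_ifs with hy
      · have hwy := h.adj_image hp hy
        exact ih (h.succ hp hy.1) (.inr hwy.1.symm) (card_le hwy)
      · exact isUnit_one

theorem isUnit_branchValue (hG : ∀ x, NoReturn G x) {u : W → K} (hu : ∀ x, IsUnit (u x)) (w : V) :
    IsUnit (branchValue G H (placePoint f fun _ => 1) (placePoint f u) (Fintype.card V) w w) := by
  rw [branchValue_placePoint]
  exact (hu _).mul <|
    hp.isUnit_arcValue hG hu (hp.fits_self w) (.inl rfl) (Finset.card_le_univ _)

/-- If the component of `y₀` is switched off, then the factor for its root vanishes. -/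
theorem arcValue_eq_zero {u : W → K} (hu : ∀ x y, H.Adj x y → u x = 0 → u y = 0) {y₀ : W}
    (hy₀ : u y₀ = 0) (hy₀o : y₀ ≠ o) (d : ℕ) (h : Fits H η f a x v w) (hx : u x ≠ 0)
    (hb : Branch G v w (η y₀)) :
    arcValue G H (placePoint f fun _ => 1) (placePoint f u) d a x v w = 0 := by
  classical
  induction d generalizing a x v w with
  | zero => rfl
  | succ d ih =>
    rw [arcValue_succ, hp.det_matchMatrix _ _ h]
    rcases hb.eq_or_exists_adj with hw | ⟨i, hi, hbi⟩
    · rw [← h.1, ← hw, hp.label_image hy₀o] at hx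
      exact absurd hy₀ hx
    by_cases hxi : H.Adj x (f i) ∧ f i ≠ a
    · have hfi := hp.image_label (hp.ne_right hxi.1)
      have fits := h.succ hp hxi.1
      rw [hfi] at fits
      have factor := ih fits (fun hi => hx (hu _ _ hxi.1.symm hi)) hbi
      rw [Finset.prod_eq_zero (i := f i) (Finset.mem_univ _), mul_zero, mul_zero]
      rwa [if_pos hxi, hfi]
    · rw [Finset.prod_eq_zero (i := i) (Finset.mem_univ _), zero_mul, mul_zero]
      rw [if_neg hxi, if_pos hi, branchValue_placePoint]
      by_cases hui : u (f i) = 0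
      · rw [hui, zero_mul]
      · rw [ih (h.root hp hi.2 hxi) hui hbi, mul_zero]

theorem branchValue_eq_zero {u : W → K} (hu : ∀ x y, H.Adj x y → u x = 0 → u y = 0) {y₀ : W}
    (hy₀ : u y₀ = 0) (hy₀o : y₀ ≠ o) (d : ℕ) (hb : G.Reachable w (η y₀)) :
    branchValue G H (placePoint f fun _ => 1) (placePoint f u) d w w = 0 := by
  rw [branchValue_placePoint]
  by_cases hw : u (f w) = 0
  · rw [hw, zero_mul]
  · rw [hp.arcValue_eq_zero hu hy₀ hy₀o d (hp.fits_self w) hw (branch_self_iff_reachable.2 hb),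
      mul_zero]

end Placement

end Certificate

/-! ### The pattern is contained in the host if the alternating sum does not vanish -/

section Zeta

variable {K : Type*} [CommRing K] {F F' : Set (Finset ℕ)} {S : Finset ℕ} {a b : ℕ → K}

/-- The indicator function of the supersets of `S`, where sets are given by binary numbers. -/
def zeta (K : Type*) [CommRing K] (S : Finset ℕ) : ℕ → K :=
  fun t => if ∀ j ∈ S, t.testBit j = true then 1 else 0

theorem zeta_empty : zeta K ∅ = 1 := by
  ext t
  simp [zeta]

theorem zeta_mul (S T : Finset ℕ) : zeta K S * zeta K T = zeta K (S ∪ T) := by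
  ext t
  simp only [zeta, Pi.mul_apply, Finset.forall_mem_union, ite_and, mul_ite, mul_one, mul_zero]
  split_ifs <;> rfl

/-- The linear combinations of the functions `zeta K S` with `S` in a given family. -/
def zetaSpan (K : Type*) [CommRing K] (F : Set (Finset ℕ)) : Submodule K (ℕ → K) :=
  Submodule.span K (zeta K '' F)

theorem zetaSpan_mono (h : F ⊆ F') : zetaSpan K F ≤ zetaSpan K F' :=
  Submodule.span_mono (Set.image_mono h)

theorem zeta_mem_zetaSpan (h : S ∈ F) : zeta K S ∈ zetaSpan K F :=
  Submodule.subset_span ⟨S, h, rfl⟩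

theorem one_mem_zetaSpan (h : ∅ ∈ F) : (1 : ℕ → K) ∈ zetaSpan K F :=
  zeta_empty (K := K) ▸ zeta_mem_zetaSpan h

theorem const_mem_zetaSpan (h : ∅ ∈ F) (r : K) : (fun _ => r) ∈ zetaSpan K F := by
  convert Submodule.smul_mem _ r (one_mem_zetaSpan (K := K) h) using 1
  ext t
  simp

theorem const_mul_mem_zetaSpan (r : K) (ha : a ∈ zetaSpan K F) :
    (fun _ => r) * a ∈ zetaSpan K F :=
  Submodule.smul_mem _ r ha

theorem mul_mem_zetaSpan {F'' : Set (Finset ℕ)} (ha : a ∈ zetaSpan K F) (hb : b ∈ zetaSpan K F')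
    (h : ∀ S ∈ F, ∀ S' ∈ F', S ∪ S' ∈ F'') : a * b ∈ zetaSpan K F'' := by
  have hab := Submodule.mul_mem_mul ha hb
  rw [zetaSpan, zetaSpan, Submodule.span_mul_span] at hab
  refine Submodule.span_mono ?_ hab
  rintro _ ⟨_, ⟨S, hS, rfl⟩, _, ⟨S', hS', rfl⟩, rfl⟩
  exact ⟨S ∪ S', h S hS S' hS', (zeta_mul S S').symm⟩

theorem prod_mem_zetaSpan {ι : Type*} {s : Finset ι} {f : ι → ℕ → K} {F : ι → Set (Finset ℕ)}
    (h : ∀ i ∈ s, f i ∈ zetaSpan K (F i)) : ∏ i ∈ s, f i ∈ zetaSpan K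
      {S | ∃ c : ι → Finset ℕ, (∀ i ∈ s, c i ∈ F i) ∧ S = s.biUnion c} := by
  classical
  induction s using Finset.induction_on with
  | empty => exact one_mem_zetaSpan ⟨fun _ => ∅, by simp, by simp⟩
  | insert i s hi ih =>
    rw [Finset.prod_insert hi]
    refine mul_mem_zetaSpan (h i (by simp)) (ih fun j hj => h j (by simp [hj])) ?_
    rintro S hS _ ⟨c, hc, rfl⟩
    have update_of_mem {j : ι} (hj : j ∈ s) : Function.update c i S j = c j :=
      Function.update_of_ne (ne_of_mem_of_not_mem hj hi) _ _
    refine ⟨Function.update c i S, ?_, ?_⟩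
    · rw [Finset.forall_mem_insert, Function.update_self]
      exact ⟨hS, fun j hj => update_of_mem hj ▸ hc j hj⟩
    · rw [Finset.biUnion_insert, Function.update_self]
      exact congrArg _ (Finset.biUnion_congr rfl fun j hj => (update_of_mem hj).symm)

/-- The sign of the set given by the binary number `t`. -/
def setSign (K : Type*) [CommRing K] (k t : ℕ) : K :=
  ∏ j ∈ Finset.range k, if t.testBit j then 1 else -1

theorem testBit_xor_two_pow_of_ne {i j : ℕ} (h : i ≠ j) (t : ℕ) :
    (t ^^^ 2 ^ j).testBit i = t.testBit i := by
  simp [Nat.testBit_xor, h.symm]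

theorem zeta_xor_two_pow {j : ℕ} (hS : j ∉ S) (t : ℕ) : zeta K S (t ^^^ 2 ^ j) = zeta K S t := by
  have testBit_iff : (∀ i ∈ S, (t ^^^ 2 ^ j).testBit i = true) ↔ ∀ i ∈ S, t.testBit i = true :=
    forall₂_congr fun i hi => by rw [testBit_xor_two_pow_of_ne (ne_of_mem_of_not_mem hi hS)]
  simp only [zeta, testBit_iff]

theorem setSign_xor_two_pow {k j : ℕ} (hj : j < k) (t : ℕ) :
    setSign K k (t ^^^ 2 ^ j) = -setSign K k t := by
  have hj := Finset.mem_range.2 hj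
  rw [setSign, setSign, ← Finset.mul_prod_erase _ _ hj, ← Finset.mul_prod_erase _ _ hj, ← neg_mul]
  congr 1
  · cases h : t.testBit j <;> simp [Nat.testBit_xor, h]
  · refine Finset.prod_congr rfl fun i hi => ?_
    rw [testBit_xor_two_pow_of_ne (Finset.ne_of_mem_erase hi)]

theorem sum_setSign_mul_zeta {k j : ℕ} (hj : j < k) (hS : j ∉ S) :
    ∑ t ∈ Finset.range (2 ^ k), setSign K k t * zeta K S t = 0 := by
  refine Finset.sum_involution (fun t _ => t ^^^ 2 ^ j) (fun t _ => ?_) (fun t _ _ h => ?_)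
    (fun t ht => ?_) (fun t _ => ?_)
  · rw [zeta_xor_two_pow hS, setSign_xor_two_pow hj, neg_mul, add_neg_cancel]
  · simpa using congrArg (Nat.testBit · j) h
  · exact Finset.mem_range.2 (Nat.xor_lt_two_pow (Finset.mem_range.1 ht)
      (Nat.pow_lt_pow_right one_lt_two hj))
  · rw [Nat.xor_assoc, Nat.xor_self, Nat.xor_zero]

theorem exists_of_sum_setSign_mul_ne_zero {k : ℕ} {b : ℕ → K} (hb : b ∈ zetaSpan K F)
    (hne : ∑ t ∈ Finset.range (2 ^ k), setSign K k t * b t ≠ 0) : ∃ S ∈ F, ∀ j < k, j ∈ S := by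
  by_contra! h
  let L : (ℕ → K) →ₗ[K] K := ∑ t ∈ Finset.range (2 ^ k), setSign K k t • LinearMap.proj t
  have apply_L (b : ℕ → K) : L b = ∑ t ∈ Finset.range (2 ^ k), setSign K k t * b t := by simp [L]
  have hF : zetaSpan K F ≤ LinearMap.ker L := by
    refine Submodule.span_le.2 ?_
    rintro _ ⟨S, hS, rfl⟩
    obtain ⟨j, hj, hjS⟩ := h S hS
    exact (apply_L _).trans (sum_setSign_mul_zeta hj hjS)
  exact hne ((apply_L b).symm.trans (hF hb))

end Zeta

section EmbedsOn

variable {V W X ι : Type*} {G : SimpleGraph V} {H : SimpleGraph W} {F : SimpleGraph X}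
  {η : W → V} {A B : Set W} {U T : Set V}

/-- The map `η` embeds the part of `H` induced by `A` into the part of `G` induced by `U`. -/
def EmbedsOn (G : SimpleGraph V) (H : SimpleGraph W) (η : W → V) (A : Set W) (U : Set V) : Prop :=
  Set.MapsTo η A U ∧ Set.InjOn η A ∧ ∀ x ∈ A, ∀ y ∈ A, H.Adj x y → G.Adj (η x) (η y)

namespace EmbedsOn

theorem of_isEmpty (hA : ∀ x, x ∉ A) : EmbedsOn G H η A U :=
  ⟨fun x hx => absurd hx (hA x), fun x hx => absurd hx (hA x), fun x hx => absurd hx (hA x)⟩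

theorem mono (h : EmbedsOn G H η B U) (hA : A ⊆ B) (hU : U ⊆ T) : EmbedsOn G H η A T :=
  ⟨h.1.mono hA hU, h.2.1.mono hA, fun x hx y hy => h.2.2 x (hA hx) y (hA hy)⟩

theorem comp {θ : X → W} {C : Set X} (h : EmbedsOn G H η B U) (hθ : EmbedsOn H F θ C B) :
    EmbedsOn G F (η ∘ θ) C U :=
  ⟨h.1.comp hθ.1, h.2.1.comp hθ.2.1 hθ.1,
    fun x hx y hy hxy => h.2.2 _ (hθ.1 hx) _ (hθ.1 hy) (hθ.2.2 x hx y hy hxy)⟩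

theorem glue {η : ι → W → V} {B : ι → Set W} {U : ι → Set V} {p : W → ι}
    (h : ∀ i ∈ p '' A, EmbedsOn G H (η i) (B i) (U i)) (hB : ∀ x ∈ A, x ∈ B (p x))
    (hU : ∀ i j u, u ∈ U i → u ∈ U j → i = j) (hp : ∀ x ∈ A, ∀ y ∈ A, H.Adj x y → p x = p y) :
    EmbedsOn G H (fun x => η (p x) x) A (⋃ i, U i) := by
  have mem (x : W) (hx : x ∈ A) : η (p x) x ∈ U (p x) := (h _ ⟨x, hx, rfl⟩).1 (hB x hx)
  refine ⟨fun x hx => Set.mem_iUnion_of_mem _ (mem x hx), fun x hx y hy e => ?_,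
    fun x hx y hy hxy => ?_⟩
  · dsimp only at e
    have hpxy := hU _ _ _ (mem x hx) (e ▸ mem y hy)
    rw [← hpxy] at e
    exact (h _ ⟨x, hx, rfl⟩).2.1 (hB x hx) (hpxy ▸ hB y hy) e
  · have hpxy := hp x hx y hy hxy
    dsimp only
    rw [← hpxy]
    exact (h _ ⟨x, hx, rfl⟩).2.2 x (hB x hx) y (hpxy ▸ hB y hy) hxy

theorem update [DecidableEq W] {x : W} {w : V}
    (h : EmbedsOn G H η {y | y ∈ A ∧ y ≠ x} {u | u ∈ U ∧ u ≠ w}) (hw : w ∈ U)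
    (hadj : ∀ y ∈ A, H.Adj x y → G.Adj w (η y)) :
    EmbedsOn G H (Function.update η x w) A U := by
  have update_self : Function.update η x w x = w := Function.update_self _ _ _
  have update_of_ne {y : W} (hy : y ≠ x) : Function.update η x w y = η y :=
    Function.update_of_ne hy _ _
  refine ⟨fun y hy => ?_, fun y hy z hz e => ?_, fun y hy z hz hyz => ?_⟩
  · by_cases hyx : y = x
    · rwa [hyx, update_self]
    · exact update_of_ne hyx ▸ (h.1 ⟨hy, hyx⟩).1
  · by_cases hyx : y = x <;> by_cases hzx : z = x
    · rw [hyx, hzx]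
    · rw [hyx, update_self, update_of_ne hzx] at e
      exact absurd e.symm (h.1 ⟨hz, hzx⟩).2
    · rw [hzx, update_self, update_of_ne hyx] at e
      exact absurd e (h.1 ⟨hy, hyx⟩).2
    · rw [update_of_ne hyx, update_of_ne hzx] at e
      exact h.2.1 ⟨hy, hyx⟩ ⟨hz, hzx⟩ e
  · by_cases hyx : y = x
    · rw [hyx, update_self, update_of_ne (hyx ▸ hyz.ne')]
      exact hadj z hz (hyx ▸ hyz)
    by_cases hzx : z = x
    · rw [hzx, update_self, update_of_ne hyx]
      exact (hadj y hy (hzx ▸ hyz.symm)).symm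
    · rw [update_of_ne hyx, update_of_ne hzx]
      exact h.2.2 y ⟨hy, hyx⟩ z ⟨hz, hzx⟩ hyz

end EmbedsOn

end EmbedsOn

section Soundness

open scoped SimpleGraph

variable {V W K : Type*} {G : SimpleGraph V} {H : SimpleGraph W} {o a x y : W} {c : W → ℕ}
  {v w i : V} {d : ℕ} {q r : V ⊕ W} {S : Finset ℕ}

/-- The vertices other than `o` of the components with number in `S`. -/
def compVerts (o : W) (c : W → ℕ) (S : Finset ℕ) : Set W := {x | x ≠ o ∧ c x ∈ S}

/-- The vertices in `A` of a first copy of the pattern and the components with number in `S` of a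
second copy. -/
def withCompVerts (o : W) (c : W → ℕ) (A : Set W) (S : Finset ℕ) : Set (W ⊕ W) :=
  {z | Sum.elim (· ∈ A) (· ∈ compVerts o c S) z}

/-- The sets of components that can be embedded into a branch. -/
def freeSets (G : SimpleGraph V) (H : SimpleGraph W) (o : W) (c : W → ℕ) (v w : V) :
    Set (Finset ℕ) :=
  {S | ∃ η, EmbedsOn G H η (compVerts o c S) {u | Branch G v w u}}

/-- The sets of components that can be embedded into the branch of `G` behind the arc from `v` to
`w` together with the branch of `H` behind the arc from `a` to `x`. -/
def arcSets (G : SimpleGraph V) (H : SimpleGraph W) (o : W) (c : W → ℕ) (d : ℕ) (a x : W)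
    (v w : V) : Set (Finset ℕ) :=
  {S | FinUnfold H d a x ∧ ∃ η, η (.inl x) = w ∧
    EmbedsOn G (H ⊕g H) η (withCompVerts o c {u | Branch H a x u} S) {u | Branch G v w u}}

/-- The sets of components that can be embedded for the column `q` of `matchMatrix` if it is matched
with the row `r`, together with the branch of `H` that belongs to `q`. -/
def columnSets (G : SimpleGraph V) (H : SimpleGraph W) (o : W) (c : W → ℕ) (d : ℕ) (a x : W)
    (v w : V) (q r : V ⊕ W) : Set (Finset ℕ) :=
  {S | ∃ η,
    (∀ y, q = .inr y → H.Adj x y ∧ y ≠ a → FinUnfold H d x y ∧ G.Adj w (η (.inl y))) ∧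
    EmbedsOn G (H ⊕g H) η
      (withCompVerts o c {u | ∃ y, q = .inr y ∧ (H.Adj x y ∧ y ≠ a) ∧ Branch H x y u} S)
      {u | ∃ i, r = .inl i ∧ (G.Adj w i ∧ i ≠ v) ∧ Branch G w i u}}

theorem arcSets_subset_freeSets : arcSets G H o c d a x v w ⊆ freeSets G H o c v w := by
  rintro S ⟨-, η, -, hη⟩
  exact ⟨_, hη.comp (θ := Sum.inr)
    ⟨fun _ hy => hy, Sum.inr_injective.injOn, fun _ _ _ _ => SimpleGraph.sum_adj_inr.2⟩⟩

theorem insert_mem_freeSets (hc : ∀ x y, H.Adj x y → c x = c y)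
    (hc' : ∀ x y, x ≠ o → y ≠ o → c x = c y → H.Reachable x y) (hx : x ≠ o)
    (hS : S ∈ arcSets G H o c d x x v w) : {c x} ∪ S ∈ freeSets G H o c v w := by
  classical
  obtain ⟨-, η, -, hη⟩ := hS
  refine ⟨_, hη.comp (θ := fun y => if c y = c x then .inl y else .inr y)
    ⟨fun y hy => ?_, fun y _ z _ e => ?_, fun y _ z _ hyz => ?_⟩⟩
  · dsimp only
    split_ifs with hyx
    · exact branch_self_iff_reachable.2 (hc' x y hx hy.1 hyx.symm)
    · exact ⟨hy.1, by simpa [hyx] using hy.2⟩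
  · dsimp only at e
    split_ifs at e
    · exact Sum.inl_injective e
    · exact Sum.inr_injective e
  · simp only [hc y z hyz]
    split_ifs
    · exact SimpleGraph.sum_adj_inl.2 hyz
    · exact SimpleGraph.sum_adj_inr.2 hyz

theorem empty_mem_columnSets (hq : ∀ y, q = .inr y → ¬(H.Adj x y ∧ y ≠ a)) :
    ∅ ∈ columnSets G H o c d a x v w q r := by
  refine ⟨fun _ => w, fun y hy hxy => absurd hxy (hq y hy), .of_isEmpty ?_⟩
  rintro (u | u) hu
  · obtain ⟨y, hy, hxy, -⟩ := hu
    exact hq y hy hxy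
  · exact Finset.notMem_empty _ hu.2

theorem freeSets_subset_columnSets {j : V} (hi : G.Adj w i ∧ i ≠ v) :
    freeSets G H o c w i ⊆ columnSets G H o c d a x v w (.inl j) (.inl i) := by
  rintro S ⟨η, hη⟩
  refine ⟨Sum.elim η η, by simp, ?_⟩
  refine .mono (B := Sum.inr '' compVerts o c S) ⟨?_, ?_, ?_⟩ ?_ fun u hu => ⟨i, rfl, hi, hu⟩
  · rintro _ ⟨y, hy, rfl⟩
    exact hη.1 hy
  · rintro _ ⟨y, hy, rfl⟩ _ ⟨z, hz, rfl⟩ e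
    exact congrArg _ (hη.2.1 hy hz e)
  · rintro _ ⟨y, hy, rfl⟩ _ ⟨z, hz, rfl⟩ hyz
    exact hη.2.2 y hy z hz (SimpleGraph.sum_adj_inr.1 hyz)
  · rintro (u | u) hu
    · obtain ⟨y, ⟨⟩, -⟩ := hu
    · exact ⟨u, hu, rfl⟩

theorem arcSets_subset_columnSets (hi : G.Adj w i ∧ i ≠ v) :
    arcSets G H o c d x y w i ⊆ columnSets G H o c d a x v w (.inr y) (.inl i) := by
  rintro S ⟨hd, η, hηy, hη⟩
  refine ⟨η, ?_, hη.mono ?_ fun u hu => ⟨i, rfl, hi, hu⟩⟩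
  · rintro _ ⟨⟩ -
    exact ⟨hd, hηy.symm ▸ hi.1⟩
  · rintro (u | u) hu
    · obtain ⟨_, ⟨⟩, -, hu⟩ := hu
      exact hu
    · exact hu

section Glue

variable {η : V ⊕ W → W ⊕ W → V} {τ : Equiv.Perm (V ⊕ W)} {S : V ⊕ W → Finset ℕ}

theorem exists_forall_branch_eq
    (hd : ∀ y, H.Adj x y ∧ y ≠ a → FinUnfold H d x y) :
    ∃ p : W → W, ∀ y u, H.Adj x y ∧ y ≠ a → Branch H x y u → p u = y := by
  choose! p hp using fun u (h : ∃ y, (H.Adj x y ∧ y ≠ a) ∧ Branch H x y u) => h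
  refine ⟨p, fun y u hy hu => by_contra fun hne => ?_⟩
  obtain ⟨hpy, hpu⟩ := hp u ⟨y, hy, hu⟩
  exact (hd _ hpy).not_branch hpy.1 hy.1 hne (hpu.trans (hu.symm hy.1.ne'))

theorem eq_of_mem_columns (hG : NoReturn G w) {u : V} (q q' : V ⊕ W)
    (hq : ∃ i, τ q = .inl i ∧ (G.Adj w i ∧ i ≠ v) ∧ Branch G w i u)
    (hq' : ∃ i, τ q' = .inl i ∧ (G.Adj w i ∧ i ≠ v) ∧ Branch G w i u) : q = q' := by
  obtain ⟨i, hi, hwi, hu⟩ := hq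
  obtain ⟨i', hi', hwi', hu'⟩ := hq'
  obtain rfl := hG.eq_of_branch hwi.1 hwi'.1 hu hu'
  exact τ.injective (hi.trans hi'.symm)

theorem biUnion_mem_arcSets [Fintype V] [Fintype W] (hG : NoReturn G w)
    (hc : ∀ x y, H.Adj x y → c x = c y) (hv : v = w ∨ G.Adj w v)
    (hS : ∀ q, S q ∈ columnSets G H o c d a x v w q (τ q)) :
    Finset.univ.biUnion S ∈ arcSets G H o c (d + 1) a x v w := by
  classical
  choose η hroot hη using hS
  have root (y : W) (hy : H.Adj x y ∧ y ≠ a) := hroot (.inr y) y rfl hy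
  obtain ⟨child, child_eq⟩ := exists_forall_branch_eq fun y hy => (root y hy).1
  have : Nonempty (V ⊕ W) := ⟨.inr x⟩
  choose! column mem_column using fun j (hj : j ∈ Finset.univ.biUnion S) => Finset.mem_biUnion.1 hj
  have glued := EmbedsOn.glue (G := G) (H := H ⊕g H) (η := η)
    (p := Sum.elim (.inr ∘ child) (column ∘ c))
    (A := {z | z ∈ withCompVerts o c {u | Branch H a x u} (Finset.univ.biUnion S) ∧ z ≠ .inl x})
    (fun q _ => hη q) ?_ (fun _ _ _ => eq_of_mem_columns hG _ _) ?_
  · refine ⟨fun y hxy hya => (root y ⟨hxy, hya⟩).1, _, Function.update_self _ _ _,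
      (glued.mono subset_rfl ?_).update (.refl v w) ?_⟩
    · intro u hu
      obtain ⟨q, i, -, hi, hu⟩ := Set.mem_iUnion.1 hu
      exact ⟨hu.of_adj hG hv hi, hu.ne hi.1.ne'⟩
    · rintro (u | u) hu hxu
      · have hxu := SimpleGraph.sum_adj_inl.1 hxu
        have hu : H.Adj x u ∧ u ≠ a := ⟨hxu, fun e => hu.ne (e ▸ hxu.ne) e⟩
        simpa [child_eq u u hu (.refl x u)] using (root u hu).2
      · simp at hxu
  · rintro (u | u) ⟨hu, hux⟩
    · obtain ⟨y, hy, hyu⟩ := hu.eq_or_exists_adj.resolve_left fun e => hux (e ▸ rfl)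
      exact ⟨y, congrArg _ (child_eq y u hy hyu), hy, hyu⟩
    · exact ⟨hu.1, (mem_column _ hu.2).2⟩
  · rintro (u | u) ⟨hu, hux⟩ (u' | u') ⟨-, hux'⟩ huu'
    · obtain ⟨y, hy, hyu⟩ := hu.eq_or_exists_adj.resolve_left fun e => hux (e ▸ rfl)
      have hyu' := hyu.step (SimpleGraph.sum_adj_inl.1 huu') fun e => hux' (e ▸ rfl)
      simp [child_eq y u hy hyu, child_eq y u' hy hyu']
    · simp at huu'
    · simp at huu'
    · simp [hc u u' (SimpleGraph.sum_adj_inr.1 huu')]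

end Glue

theorem isContained_of_forall_mem_freeSets (hc : ∀ x y, H.Adj x y → c x = c y) {s : Finset V}
    (hs : ∀ w ∈ s, ∀ w' ∈ s, G.Reachable w w' → w = w') {S : V → Finset ℕ}
    (hS : ∀ w ∈ s, S w ∈ freeSets G H o c w w) :
    H.induce (compVerts o c (s.biUnion S)) ⊑ G := by
  classical
  rcases isEmpty_or_nonempty (compVerts o c (s.biUnion S)) with hV | ⟨⟨x, hx⟩⟩
  · exact .of_isEmpty
  obtain ⟨w₀, -, -⟩ := Finset.mem_biUnion.1 hx.2
  have : Nonempty V := ⟨w₀⟩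
  choose! η hη using hS
  choose! p hp using fun j (hj : j ∈ s.biUnion S) => Finset.mem_biUnion.1 hj
  have glued := EmbedsOn.glue (G := G) (H := H) (A := compVerts o c (s.biUnion S)) (η := η)
    (p := p ∘ c) (B := fun w => compVerts o c (S w)) (U := fun w => {u | w ∈ s ∧ Branch G w w u})
    ?_ (fun x hx => ⟨hx.1, (hp _ hx.2).2⟩) ?_ fun x _ y _ hxy => congrArg p (hc x y hxy)
  · exact ⟨⟨⟨fun x => η (p (c x)) x, fun {x y} => glued.2.2 x x.2 y y.2⟩,
      fun x y e => Subtype.ext (glued.2.1 x.2 y.2 e)⟩⟩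
  · rintro _ ⟨x, hx, rfl⟩
    have hxs := (hp _ hx.2).1
    exact ⟨fun y hy => ⟨hxs, (hη _ hxs).1 hy⟩, (hη _ hxs).2⟩
  · rintro w w' u ⟨hw, hu⟩ ⟨hw', hu'⟩
    rw [branch_self_iff_reachable] at hu hu'
    exact hs w hw w' hw' (hu.trans hu'.symm)

variable [CommRing K]

open Classical in
/-- The values that mark the roots of the embedded components, as functions of the set of components
that may be embedded. -/
noncomputable def rootValue (o : W) (c : W → ℕ) (ξ : W → V → K) (x : W) (w : V) : ℕ → K :=
  fun t => if x = o ∨ t.testBit (c x) = true then ξ x w else 0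

theorem branchValue_mem_zetaSpan [Fintype V] [Fintype W]
    (hc : ∀ x y, H.Adj x y → c x = c y)
    (hc' : ∀ x y, x ≠ o → y ≠ o → c x = c y → H.Reachable x y) {ξ : W → V → K}
    {z y : W → V → ℕ → K} (hy : y = rootValue o c ξ)
    (h : ∀ x, arcValue G H z y d x x v w ∈ zetaSpan K (arcSets G H o c d x x v w)) :
    branchValue G H z y d v w ∈ zetaSpan K (freeSets G H o c v w) := by
  classical
  refine Submodule.sum_mem _ fun x _ => ?_
  by_cases hx : x = o
  · have root_eq : y x w = fun _ => ξ x w := by ext t; simp [hy, rootValue, hx]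
    rw [root_eq]
    exact const_mul_mem_zetaSpan _ (zetaSpan_mono arcSets_subset_freeSets (h x))
  · have root_eq : y x w = (fun _ => ξ x w) * zeta K {c x} := by
      ext t; simp [hy, rootValue, zeta, hx]
    rw [root_eq, mul_assoc]
    refine const_mul_mem_zetaSpan _ (mul_mem_zetaSpan (zeta_mem_zetaSpan rfl) (h x) ?_)
    rintro _ rfl S hS
    exact insert_mem_freeSets hc hc' hx hS

theorem matchMatrix_apply_mem_zetaSpan {z : W → V → K} {P : W → W → V → V → ℕ → K}
    {Z : V → V → ℕ → K}
    (hP : ∀ y i, G.Adj w i ∧ i ≠ v → P x y w i ∈ zetaSpan K (arcSets G H o c d x y w i))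
    (hZ : ∀ i, G.Adj w i ∧ i ≠ v → Z w i ∈ zetaSpan K (freeSets G H o c w i)) (r q : V ⊕ W) :
    matchMatrix G H (fun x w _ => z x w) P Z a x v w r q ∈
      zetaSpan K (columnSets G H o c d a x v w q r) := by
  classical
  rcases r with i | y' <;> rcases q with j | y <;> simp only [matchMatrix, Matrix.of_apply]
  · split_ifs with hij hi
    · exact zetaSpan_mono (freeSets_subset_columnSets hi) (hZ i hi)
    · exact one_mem_zetaSpan (empty_mem_columnSets nofun)
    · exact Submodule.zero_mem _
  · split_ifs with h
    · exact const_mul_mem_zetaSpan _ (zetaSpan_mono (arcSets_subset_columnSets h.1) (hP y i h.1))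
    · exact Submodule.zero_mem _
  · split_ifs
    · exact const_mem_zetaSpan (empty_mem_columnSets nofun) _
    · exact Submodule.zero_mem _
  · split_ifs with _ hy
    · exact Submodule.zero_mem _
    · subst y'
      exact one_mem_zetaSpan (empty_mem_columnSets fun _ e => Sum.inr_injective e ▸ hy)
    · exact Submodule.zero_mem _

variable [Fintype V] [Fintype W]

theorem arcValue_mem_zetaSpan (hG : ∀ x, NoReturn G x) (hc : ∀ x y, H.Adj x y → c x = c y)
    (hc' : ∀ x y, x ≠ o → y ≠ o → c x = c y → H.Reachable x y) (ξ : W → V → K)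
    (hv : v = w ∨ G.Adj w v) :
    arcValue G H (fun x w _ => ξ x w) (rootValue o c ξ) d a x v w ∈
      zetaSpan K (arcSets G H o c d a x v w) := by
  classical
  induction d generalizing a x v w with
  | zero => exact Submodule.zero_mem _
  | succ d ih =>
    rw [arcValue_succ, Matrix.det_apply]
    refine Submodule.sum_mem _ fun τ _ => Submodule.smul_of_tower_mem _ _ ?_
    refine zetaSpan_mono ?_ (prod_mem_zetaSpan fun q _ =>
      matchMatrix_apply_mem_zetaSpan (fun y i hi => ih (.inr hi.1.symm))
        (fun i hi => branchValue_mem_zetaSpan hc hc' rfl fun x => ih (.inr hi.1.symm)) (τ q) q)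
    rintro _ ⟨S, hS, rfl⟩
    exact biUnion_mem_arcSets (hG w) hc hv fun q => hS q (Finset.mem_univ q)

theorem isContained_of_sum_ne_zero (hG : ∀ x, NoReturn G x) (hc : ∀ x y, H.Adj x y → c x = c y)
    (hc' : ∀ x y, x ≠ o → y ≠ o → c x = c y → H.Reachable x y) {k : ℕ}
    (hk : ∀ x, x ≠ o → c x < k) {ξ : W → V → K} {s : Finset V}
    (hs : ∀ w ∈ s, ∀ w' ∈ s, G.Reachable w w' → w = w')
    (hne : ∑ t ∈ Finset.range (2 ^ k), setSign K k t *
      ∏ w ∈ s, branchValue G H ξ (fun x w => rootValue o c ξ x w t) d w w ≠ 0) :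
    H.induce {x | x ≠ o} ⊑ G := by
  classical
  have prod_eq (t : ℕ) : ∏ w ∈ s, branchValue G H ξ (fun x w => rootValue o c ξ x w t) d w w =
      (∏ w ∈ s, branchValue G H (fun x w _ => ξ x w) (rootValue o c ξ) d w w) t := by
    rw [Finset.prod_apply]
    exact Finset.prod_congr rfl fun w _ =>
      (map_branchValue (Pi.evalRingHom (fun _ => K) t) (fun x w _ => ξ x w) (rootValue o c ξ) d w
        w).symm
  simp only [prod_eq] at hne
  obtain ⟨_, ⟨S, hS, rfl⟩, hkS⟩ := exists_of_sum_setSign_mul_ne_zero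
    (prod_mem_zetaSpan fun w _ => branchValue_mem_zetaSpan hc hc' rfl fun x =>
      arcValue_mem_zetaSpan hG hc hc' ξ (.inl rfl)) hne
  have compVerts_eq : compVerts o c (s.biUnion S) = {x | x ≠ o} :=
    Set.ext fun x => and_iff_left_of_imp fun hx => hkS _ (hk x hx)
  exact compVerts_eq ▸ isContained_of_forall_mem_freeSets hc hs hS

end Soundness

section AltSum

open MvPolynomial

variable {V W K : Type*} {G : SimpleGraph V} {H : SimpleGraph W}

variable {o : W} {c : W → ℕ} {k : ℕ} {s : Finset V}

theorem isUnit_setSign [CommRing K] (k t : ℕ) : IsUnit (setSign K k t) := by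
  rw [setSign, IsUnit.prod_iff]
  intro j _
  split_ifs
  exacts [isUnit_one, isUnit_one.neg]

theorem exists_testBit_eq_false {t : ℕ} (ht : t < 2 ^ k) (hne : t ≠ 2 ^ k - 1) :
    ∃ j < k, t.testBit j = false := by
  by_contra! h
  refine hne (Nat.eq_of_testBit_eq fun j => ?_)
  rw [Nat.testBit_two_pow_sub_one]
  by_cases hj : j < k
  · simpa [hj] using h j hj
  · simpa [hj] using Nat.testBit_lt_two_pow
      (ht.trans_le (Nat.pow_le_pow_right two_pos (not_lt.1 hj)))

open Classical in
theorem rootValue_placePoint [CommRing K] (f : V → W) (t : ℕ) :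
    (fun x w => rootValue o c (placePoint f fun _ => (1 : K)) x w t) =
      placePoint f fun x => if x = o ∨ t.testBit (c x) = true then 1 else 0 := by
  funext x w
  simp only [rootValue, placePoint]
  split_ifs <;> rfl

variable [Fintype V] [Fintype W]

/-- The alternating sum, over all sets of components of the pattern, of the product of the values of
the components of the host, which are represented by the vertices in `s`. -/
noncomputable def altSum [CommRing K] (G : SimpleGraph V) (H : SimpleGraph W) (o : W) (c : W → ℕ)
    (k : ℕ) (s : Finset V) (ξ : W → V → K) : K :=
  ∑ t ∈ Finset.range (2 ^ k), setSign K k t *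
    ∏ w ∈ s, branchValue G H ξ (fun x w => rootValue o c ξ x w t) (Fintype.card V) w w

theorem map_altSum {L : Type*} [CommRing K] [CommRing L] (φ : K →+* L) (ξ : W → V → K) :
    φ (altSum G H o c k s ξ) = altSum G H o c k s fun x w => φ (ξ x w) := by
  simp only [altSum, map_sum, map_mul, map_prod, map_branchValue, setSign, rootValue, apply_ite φ,
    map_zero, map_one, map_neg]

theorem totalDegree_setSign {σ : Type*} [CommRing K] (k t : ℕ) :
    (setSign (MvPolynomial σ K) k t).totalDegree = 0 := by
  refine Nat.le_zero.1 ((totalDegree_finsetProd _ _).trans ?_)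
  rw [Nat.le_zero, Finset.sum_eq_zero]
  intro j _
  split_ifs <;> simp

theorem totalDegree_altSum_le {σ : Type*} [CommRing K] (hG : ∀ x, NoReturn G x)
    (hs : ∀ w ∈ s, ∀ w' ∈ s, G.Reachable w w' → w = w') {ξ : W → V → MvPolynomial σ K}
    (hξ : ∀ x w, (ξ x w).totalDegree ≤ 1) :
    (altSum G H o c k s ξ).totalDegree ≤
      (Fintype.card V + Fintype.card W + 1) * Fintype.card V := by
  refine totalDegree_finsetSum_le fun t _ => (totalDegree_mul _ _).trans ?_
  rw [totalDegree_setSign, zero_add]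
  have root_le (x w) : (rootValue o c ξ x w t).totalDegree ≤ 1 := by
    unfold rootValue
    split_ifs
    · exact hξ x w
    · simp
  calc _ ≤ ∑ w ∈ s, (branchValue G H ξ (fun x w => rootValue o c ξ x w t) _ w w).totalDegree :=
        totalDegree_finsetProd _ _
    _ ≤ ∑ w ∈ s, ((Fintype.card V + Fintype.card W) * branchCard G w w + 1) :=
        Finset.sum_le_sum fun w _ => totalDegree_branchValue_le hG hξ root_le (.inl rfl)
    _ = (Fintype.card V + Fintype.card W) * ∑ w ∈ s, branchCard G w w + s.card := by
        rw [Finset.sum_add_distrib, Finset.mul_sum, Finset.card_eq_sum_ones]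
    _ ≤ (Fintype.card V + Fintype.card W) * Fintype.card V + Fintype.card V :=
        Nat.add_le_add (Nat.mul_le_mul_left _ (sum_branchCard_le_card hs)) (Finset.card_le_univ _)
    _ = _ := by ring

/-- The set of all components contributes a unit, and every other set contributes zero, since some
component is switched off. -/
theorem altSum_placePoint_ne_zero [CommRing K] [Nontrivial K] (hG : ∀ x, NoReturn G x)
    {η : W → V} {f : V → W} (hp : Placement G H o η f) (hc : ∀ x y, H.Adj x y → c x = c y)
    (hk : ∀ j < k, ∃ x, x ≠ o ∧ c x = j) (hk' : ∀ x, x ≠ o → c x < k)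
    (hs : ∀ v, ∃ w ∈ s, G.Reachable w v) :
    altSum G H o c k s (placePoint f fun _ => (1 : K)) ≠ 0 := by
  classical
  simp only [altSum, rootValue_placePoint]
  have all_mem : 2 ^ k - 1 ∈ Finset.range (2 ^ k) :=
    Finset.mem_range.2 (Nat.sub_lt (by positivity) one_pos)
  rw [Finset.sum_eq_single_of_mem _ all_mem]
  · refine ((isUnit_setSign _ _).mul (IsUnit.prod_iff.2 fun w _ =>
      hp.isUnit_branchValue hG (fun x => ?_) w)).ne_zero
    rw [if_pos]
    · exact isUnit_one
    · simpa [Nat.testBit_two_pow_sub_one, or_iff_not_imp_left] using hk' x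
  · intro t ht hne
    obtain ⟨j, hj, hbit⟩ := exists_testBit_eq_false (Finset.mem_range.1 ht) hne
    obtain ⟨y, hyo, rfl⟩ := hk j hj
    obtain ⟨w, hw, hwy⟩ := hs (η y)
    rw [Finset.prod_eq_zero hw, mul_zero]
    refine hp.branchValue_eq_zero (fun x x' hxx' hx => ?_) (y₀ := y) (by simp [hyo, hbit]) hyo _ hwy
    simpa only [hp.ne_left hxx', hp.ne_right hxx', false_or, hc _ _ hxx'] using hx

end AltSum

/-! ### The probability of an error -/

section Probability

open MvPolynomial

variable {σ κ K : Type*} [Fintype κ] [Field K] {P : MvPolynomial σ K}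

theorem ofBits_injective (b : ℕ) : Function.Injective (Nat.ofBits : (Fin b → Bool) → ℕ) := by
  intro f g h
  funext i
  rw [← Nat.testBit_ofBits_lt f i i.2, h, Nat.testBit_ofBits_lt]

theorem ofBits_eq_sum {b : ℕ} (f : Fin b → Bool) :
    Nat.ofBits f = ∑ i, if f i = true then 2 ^ (i : ℕ) else 0 := by
  induction b with
  | zero => rfl
  | succ b ih =>
    rw [Nat.ofBits_succ, ih, Fin.sum_univ_succ, Finset.mul_sum, add_comm]
    congr 1
    · cases f 0 <;> rfl
    · simp only [mul_ite, mul_zero, Function.comp_apply, Fin.val_succ, pow_succ']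

open Classical in
theorem two_mul_card_filter_eval_eq_zero_le [Fintype σ] (hP : P ≠ 0) {S : Finset K}
    (hS' : S.Nonempty) (hS : 2 * P.totalDegree ≤ S.card) :
    2 * ((Fintype.piFinset fun _ => S).filter fun f => eval f P = 0).card ≤
      S.card ^ Fintype.card σ := by
  let e := Fintype.equivFin σ
  have hP' : rename e P ≠ 0 := (map_ne_zero_iff _ (rename_injective e e.injective)).2 hP
  have card_eq : ((Fintype.piFinset fun _ => S).filter fun f => eval f P = 0).card =
      ((Fintype.piFinset fun _ => S).filter fun f => eval f (rename e P) = 0).card := by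
    refine Finset.card_bij' (fun f _ => f ∘ e.symm) (fun f _ => f ∘ e) ?_ ?_ ?_ ?_ <;>
      simp +contextual [eval_rename, Function.comp_assoc]
  have pos : (0 : ℚ≥0) < S.card := Nat.cast_pos.2 hS'.card_pos
  have card_le := calc
    _ ≤ ((rename e P).totalDegree : ℚ≥0) / S.card := schwartz_zippel_totalDegree hP' S
    _ ≤ P.totalDegree / S.card := by gcongr; exact totalDegree_rename_le e P
    _ ≤ 1 / 2 := by
      rw [div_le_div_iff₀ pos two_pos, one_mul, mul_comm]
      exact_mod_cast hS
  rw [div_le_div_iff₀ (by positivity) two_pos, one_mul, mul_comm] at card_le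
  rw [card_eq]
  exact_mod_cast card_le

/-- Random bits that determine distinct points are independent of all further bits. -/
theorem two_mul_card_eval_ofBits_eq_zero_le [Finite σ] (hP : P ≠ 0) {b : ℕ} (e : σ × Fin b ↪ κ)
    (hb : 2 * P.totalDegree ≤ 2 ^ b) (hK : Set.InjOn (Nat.cast : ℕ → K) (Set.Iio (2 ^ b))) :
    2 * Nat.card {r : κ → Bool // eval (fun i => (Nat.ofBits fun j => r (e (i, j)) : K)) P = 0} ≤
      2 ^ Fintype.card κ := by
  classical
  cases nonempty_fintype σ
  let S : Finset K := (Finset.range (2 ^ b)).image Nat.cast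
  have card_S : S.card = 2 ^ b := by
    rw [Finset.card_image_of_injOn (by simpa using hK), Finset.card_range]
  let Z : Finset (σ → K) := (Fintype.piFinset fun _ => S).filter fun f => eval f P = 0
  let point (r : κ → Bool) (i : σ) : K := (Nat.ofBits fun j => r (e (i, j)) : ℕ)
  let split (r : {r // eval (point r) P = 0}) : Z × (↥(Set.range e)ᶜ → Bool) :=
    (⟨point r, Finset.mem_filter.2 ⟨Fintype.mem_piFinset.2 fun i => Finset.mem_image_of_mem _ <|
      Finset.mem_range.2 (Nat.ofBits_lt_two_pow _), r.2⟩⟩, fun k => r.1 k)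
  have split_injective : Function.Injective split := by
    intro r r' h
    refine Subtype.ext (funext fun k => ?_)
    by_cases hk : k ∈ Set.range e
    · obtain ⟨⟨i, j⟩, rfl⟩ := hk
      have hi : point r i = point r' i := congrFun (congrArg (fun p => (p.1 : σ → K)) h) i
      exact congrFun (ofBits_injective b
        (hK (Nat.ofBits_lt_two_pow _) (Nat.ofBits_lt_two_pow _) hi)) j
    · exact congrFun (congrArg Prod.snd h) ⟨k, hk⟩
  calc _ ≤ 2 * Nat.card (Z × (↥(Set.range e)ᶜ → Bool)) :=
        Nat.mul_le_mul_left 2 (Nat.card_le_card_of_injective split split_injective)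
    _ = 2 * Z.card * 2 ^ Fintype.card ↥(Set.range e)ᶜ := by
        simp [mul_assoc]
    _ ≤ 2 ^ (b * Fintype.card σ) * 2 ^ Fintype.card ↥(Set.range e)ᶜ := by
        rw [pow_mul, ← card_S]
        exact Nat.mul_le_mul_right _ (two_mul_card_filter_eval_eq_zero_le hP
          (Finset.nonempty_range_iff.2 (by positivity) |>.image _) (card_S ▸ hb))
    _ = 2 ^ Fintype.card κ := by
        rw [← pow_add, Fintype.card_compl_set, Set.card_range_of_injective e.injective,
          Fintype.card_prod, Fintype.card_fin, mul_comm b,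
          Nat.add_sub_cancel']
        simpa using Fintype.card_le_of_embedding e

end Probability

/-! ### Components -/

section Components

theorem getD_map_range {α : Type*} (f : ℕ → α) (d : α) {n i : ℕ} (h : i < n) :
    ((List.range n).map f).getD i d = f i := by
  simp [List.getD_eq_getElem?_getD, h]

theorem exists_of_lt_count {p : ℕ → Prop} [DecidablePred p] {n j : ℕ} (h : j < Nat.count p n) :
    ∃ m < n, p m ∧ Nat.count p m = j := by
  induction n with
  | zero => simp at h
  | succ n ih =>
    rw [Nat.count_succ] at h
    by_cases hj : j < Nat.count p n
    · obtain ⟨m, hm, hp⟩ := ih hj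
      exact ⟨m, hm.trans n.lt_succ_self, hp⟩
    · split_ifs at h with hp
      · exact ⟨n, n.lt_succ_self, hp, by lia⟩
      · exact absurd h hj

variable {n : ℕ} {A : BoolMat} {G : SimpleGraph (Fin n)} {u v w : Fin n}

/-- The list `A` is the adjacency matrix of the graph `G`. -/
structure Represents (A : BoolMat) (G : SimpleGraph (Fin n)) : Prop where
  length : A.length = n
  adj_iff : ∀ i j : Fin n, A.adjAt i j = true ↔ G.Adj i j
  lt_of_adj : ∀ i j, A.adjAt i j = true → i < n ∧ j < n

open Classical in
/-- The adjacency matrix of a graph. -/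
noncomputable def adjMat (G : SimpleGraph (Fin n)) : BoolMat :=
  List.ofFn fun i => List.ofFn fun j => decide (G.Adj i j)

theorem code_ofFn {m : ℕ} {α : Type} [Coded α] (f : Fin m → α) :
    Coded.code (List.ofFn f) = Data.ofList (List.ofFn fun i => Coded.code (f i)) := by
  change Data.ofList ((List.ofFn f).map Coded.code) = _
  rw [List.map_ofFn]
  rfl

theorem code_adjMat (G : SimpleGraph (Fin n)) : Coded.code (adjMat G) = encodeGraph G := by
  rw [adjMat, encodeGraph, code_ofFn]
  simp only [code_ofFn]
  rfl

theorem represents_adjMat (G : SimpleGraph (Fin n)) : Represents (adjMat G) G := by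
  classical
  have adjAt_iff (i j) : (adjMat G).adjAt i j = true ↔
      ∃ (hi : i < n) (hj : j < n), G.Adj ⟨i, hi⟩ ⟨j, hj⟩ := by
    by_cases hi : i < n <;> by_cases hj : j < n <;>
      simp [BoolMat.adjAt, adjMat, List.getD_eq_getElem?_getD, hi, hj]
  refine ⟨by simp [adjMat], fun i j => ?_, fun i j h => ?_⟩
  · simp [adjAt_iff]
  · obtain ⟨hi, hj, -⟩ := (adjAt_iff i j).1 h
    exact ⟨hi, hj⟩

namespace Represents

variable (hA : Represents A G)
include hA

theorem getD_iterate_reachStep (i : ℕ) (v w : Fin n) :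
    (A.reachStep^[i] ((List.range A.length).map fun u => decide (u = (v : ℕ)))).getD w false =
      true ↔ ∃ p : G.Walk w v, p.length ≤ i := by
  have lt_length (u : Fin n) : (u : ℕ) < A.length := hA.length.symm ▸ u.2
  induction i generalizing w with
  | zero =>
    rw [Function.iterate_zero_apply, getD_map_range _ _ (lt_length w), decide_eq_true_iff,
      Fin.val_inj]
    constructor
    · rintro rfl
      exact ⟨.nil, le_rfl⟩
    · rintro ⟨p, hp⟩
      exact p.eq_of_length_eq_zero (Nat.le_zero.1 hp)
  | succ i ih =>
    rw [Function.iterate_succ_apply', BoolMat.reachStep, getD_map_range _ _ (lt_length w),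
      decide_eq_true_iff]
    refine (or_congr_left (ih w)).trans ⟨?_, ?_⟩
    · rintro (⟨p, hp⟩ | ⟨u, hu, hvu, huw⟩)
      · exact ⟨p, hp.trans i.le_succ⟩
      · obtain ⟨p, hp⟩ := (ih ⟨u, hA.length ▸ hu⟩).1 hvu
        exact ⟨.cons ((hA.adj_iff ⟨u, hA.length ▸ hu⟩ w).1 huw).symm p, Nat.succ_le_succ hp⟩
    · rintro ⟨p, hp⟩
      cases p with
      | nil => exact .inl ⟨.nil, i.zero_le⟩
      | @cons _ u _ hwu p =>
        exact .inr ⟨u, lt_length u, (ih u).2 ⟨p, Nat.le_of_succ_le_succ hp⟩,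
          (hA.adj_iff u w).2 hwu.symm⟩

theorem isReachable_iff : A.IsReachable v w ↔ G.Reachable v w := by
  classical
  rw [BoolMat.IsReachable, hA.getD_iterate_reachStep, SimpleGraph.reachable_comm]
  refine ⟨fun ⟨p, _⟩ => p.reachable, fun ⟨p⟩ => ⟨p.bypass, ?_⟩⟩
  simpa [hA.length] using p.bypass_isPath.length_lt.le

theorem rep_le_of_reachable (h : G.Reachable v u) : A.rep v ≤ u := by
  by_contra! hlt
  have not_reachable := Nat.findGreatest_spec (P := fun i => ∀ j < i, ¬A.IsReachable v j)
    (Nat.zero_le v) fun j hj => absurd hj j.not_lt_zero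
  exact not_reachable u hlt (hA.isReachable_iff.2 h)

theorem exists_rep_eq (v : Fin n) : ∃ l : Fin n, A.rep v = l ∧ G.Reachable v l := by
  have hle := hA.rep_le_of_reachable (.refl v)
  refine ⟨⟨A.rep v, hle.trans_lt v.2⟩, rfl, ?_⟩
  rcases hle.eq_or_lt with hv | hlt
  · simp [hv]
  have := Nat.findGreatest_is_greatest (P := fun i => ∀ j < i, ¬A.IsReachable v j)
    (A.rep v).lt_succ_self hlt
  push Not at this
  obtain ⟨j, hj, hvj⟩ := this
  have hvj' := (hA.isReachable_iff (w := ⟨j, by lia⟩)).1 hvj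
  convert hvj'
  exact (hA.rep_le_of_reachable hvj').antisymm (Nat.le_of_lt_succ hj)

theorem rep_eq_of_reachable (h : G.Reachable v w) : A.rep v = A.rep w := by
  obtain ⟨l, hl, hvl⟩ := hA.exists_rep_eq v
  obtain ⟨l', hl', hwl'⟩ := hA.exists_rep_eq w
  refine le_antisymm ?_ ?_
  · exact hl' ▸ hA.rep_le_of_reachable (h.trans hwl')
  · exact hl ▸ hA.rep_le_of_reachable (h.symm.trans hvl)

theorem isRep_rep (v : Fin n) : A.IsRep (A.rep v) := by
  obtain ⟨l, hl, hvl⟩ := hA.exists_rep_eq v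
  rw [hl, BoolMat.IsRep, ← hA.rep_eq_of_reachable hvl, hl]

theorem eq_of_isRep (hv : A.IsRep v) (hw : A.IsRep w) (h : G.Reachable v w) : v = w :=
  Fin.ext (hv.symm.trans ((hA.rep_eq_of_reachable h).trans hw))

theorem exists_isRep (v : Fin n) : ∃ w : Fin n, A.IsRep w ∧ G.Reachable w v := by
  obtain ⟨l, hl, hvl⟩ := hA.exists_rep_eq v
  exact ⟨l, hl ▸ hA.isRep_rep v, hvl.symm⟩

theorem cc_eq_compCount : cc G = A.compCount := by
  classical
  let toComponent (v : {v : Fin n // A.IsRep v}) := G.connectedComponentMk v.1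
  have bijective : toComponent.Bijective := by
    refine ⟨fun v w h => ?_, SimpleGraph.ConnectedComponent.ind fun v => ?_⟩
    · exact Subtype.ext (hA.eq_of_isRep v.2 w.2 (SimpleGraph.ConnectedComponent.exact h))
    · obtain ⟨w, hw, hwv⟩ := hA.exists_isRep v
      exact ⟨⟨w, hw⟩, SimpleGraph.ConnectedComponent.sound hwv⟩
  rw [cc, ← Nat.card_eq_of_bijective _ bijective, BoolMat.compCount, hA.length,
    Nat.count_eq_card_filter_range, Finset.card_filter, Finset.sum_range,
    Nat.card_eq_fintype_card, Fintype.card_subtype, Finset.card_filter]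

theorem compIndex_eq_of_reachable (h : G.Reachable v w) : A.compIndex v = A.compIndex w := by
  rw [BoolMat.compIndex, BoolMat.compIndex, hA.rep_eq_of_reachable h]

theorem reachable_of_compIndex_eq (h : A.compIndex v = A.compIndex w) : G.Reachable v w := by
  have rep_eq := Nat.count_injective (hA.isRep_rep v) (hA.isRep_rep w) h
  obtain ⟨l, hl, hvl⟩ := hA.exists_rep_eq v
  obtain ⟨l', hl', hwl'⟩ := hA.exists_rep_eq w
  obtain rfl : l = l' := Fin.ext (hl.symm.trans (rep_eq.trans hl'))
  exact hvl.trans hwl'.symm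

theorem compIndex_lt (v : Fin n) : A.compIndex v < A.compCount := by
  obtain ⟨l, hl, -⟩ := hA.exists_rep_eq v
  exact Nat.count_strict_mono (hA.isRep_rep v) (by rw [hl, hA.length]; exact l.2)

theorem exists_compIndex_eq {j : ℕ} (hj : j < A.compCount) : ∃ v : Fin n, A.compIndex v = j := by
  obtain ⟨m, hm, hrep, rfl⟩ := exists_of_lt_count hj
  exact ⟨⟨m, hA.length ▸ hm⟩, congrArg (Nat.count A.IsRep) hrep⟩

end Represents

end Components

section WithIsolated

open scoped SimpleGraph

variable {n : ℕ} {H : SimpleGraph (Fin n)} {A : BoolMat}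

/-- A graph with an additional isolated vertex. -/
def withIsolated (H : SimpleGraph (Fin n)) : SimpleGraph (Fin (n + 1)) := H.map Fin.castSuccEmb

theorem withIsolated_adj_castSucc {u v : Fin n} :
    (withIsolated H).Adj u.castSucc v.castSucc ↔ H.Adj u v :=
  SimpleGraph.map_adj_apply

theorem Represents.withIsolated_adj_iff (hA : Represents A H) (x y : Fin (n + 1)) :
    (withIsolated H).Adj x y ↔ A.adjAt x y = true := by
  rw [withIsolated, SimpleGraph.map_adj]
  constructor
  · rintro ⟨u, v, h, rfl, rfl⟩
    exact (hA.adj_iff u v).2 h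
  · intro h
    obtain ⟨hx, hy⟩ := hA.lt_of_adj _ _ h
    exact ⟨⟨x, hx⟩, ⟨y, hy⟩, (hA.adj_iff ⟨x, hx⟩ ⟨y, hy⟩).1 h, rfl, rfl⟩

theorem isContained_induce_withIsolated (H : SimpleGraph (Fin n)) :
    H ⊑ (withIsolated H).induce {x | x ≠ Fin.last n} :=
  ⟨⟨⟨fun u => ⟨u.castSucc, u.castSucc_ne_last⟩, fun h => withIsolated_adj_castSucc.2 h⟩,
    fun _ _ h => Fin.castSucc_injective n (congrArg Subtype.val h)⟩⟩

theorem exists_placement {V : Type*} [Nonempty V] {G : SimpleGraph V} (h : H ⊑ G) :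
    ∃ η f, Placement G (withIsolated H) (Fin.last n) η f := by
  classical
  obtain ⟨φ⟩ := h
  let label (w : V) : Fin (n + 1) := if hw : ∃ x, φ x = w then hw.choose.castSucc else Fin.last n
  refine ⟨Fin.lastCases (Classical.arbitrary V) φ, label, fun x hx => ?_, fun w x hx => ?_,
    fun x y hxy => ?_⟩
  · obtain ⟨u, v, -, hu, -⟩ := SimpleGraph.map_adj .. |>.1 hx
    exact Fin.castSucc_ne_last u hu
  · obtain ⟨x, rfl⟩ := Fin.exists_castSucc_eq.2 hx
    rw [Fin.lastCases_castSucc]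
    by_cases hw : ∃ x, φ x = w
    · rw [show label w = _ from dif_pos hw, Fin.castSucc_inj, ← φ.injective.eq_iff, eq_comm]
      exact Eq.congr_right hw.choose_spec
    · rw [show label w = _ from dif_neg hw]
      exact ⟨fun e => absurd e.symm hx, fun e => absurd ⟨x, e⟩ hw⟩
  · obtain ⟨u, v, huv, rfl, rfl⟩ := SimpleGraph.map_adj .. |>.1 hxy
    simpa using φ.toHom.map_adj huv

end WithIsolated

/-! ### Correctness of the algorithm -/

namespace NatMat

theorem entry_ofFn {n : ℕ} (f : ℕ → ℕ → ℕ) {i j : ℕ} (hi : i < n) (hj : j < n) :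
    (ofFn n f).entry i j = f i j := by
  rw [entry, ofFn, getD_map_range _ _ hi, getD_map_range _ _ hj]

/-- The matrix over `ZMod m` given by a list of rows. -/
def toZMod (m n : ℕ) (M : NatMat) : Matrix (Fin n) (Fin n) (ZMod m) :=
  Matrix.of fun i j => (M.entry i j : ZMod m)

theorem natCast_pred (p : ℕ) : (p : ZMod (p + 1)) = -1 := by
  rw [eq_neg_iff_add_eq_zero]
  exact_mod_cast ZMod.natCast_self (p + 1)

theorem toZMod_birdStepMod (p n : ℕ) (M X : NatMat) :
    (birdStepMod p n M X).toZMod (p + 1) n =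
      birdStep (M.toZMod (p + 1) n) (X.toZMod (p + 1) n) := by
  ext i j
  simp only [toZMod, birdStep, Matrix.of_apply, birdStepMod, entry_ofFn _ i.2 j.2,
    ZMod.natCast_mod, Nat.cast_add, Nat.cast_mul, natCast_pred, Finset.sum_range, Nat.cast_sum,
    Nat.cast_ite, Nat.cast_zero, neg_one_mul, ← sub_eq_add_neg]
  simp only [Fin.val_fin_lt, ← Finset.sum_filter, Finset.filter_lt_eq_Ioi]

theorem toZMod_iterate_birdStepMod (p n d : ℕ) (M X : NatMat) :
    ((birdStepMod p n M)^[d] X).toZMod (p + 1) n =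
      (birdStep (M.toZMod (p + 1) n))^[d] (X.toZMod (p + 1) n) :=
  Function.Semiconj.iterate_right (f := toZMod (p + 1) n) (toZMod_birdStepMod p n M) d X

theorem natCast_detMod (p n : ℕ) (M : NatMat) :
    (detMod p (n + 1) M : ZMod (p + 1)) = (M.toZMod (p + 1) (n + 1)).det := by
  rw [← birdStep_iterate_bot_eq_det, Fintype.card_fin, ← toZMod_iterate_birdStepMod, detMod,
    ZMod.natCast_mod]
  rfl

end NatMat

namespace Input

variable {m n : ℕ} {H : SimpleGraph (Fin m)} {G : SimpleGraph (Fin n)} {I : Input} {r : List Bool}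
  {t d : ℕ} {T : ArcTable}

/-- The input consists of the adjacency matrices of the given graphs. -/
structure RepresentsPair (I : Input) (H : SimpleGraph (Fin m)) (G : SimpleGraph (Fin n)) :
    Prop where
  pattern : Represents I.matH H
  host : Represents I.matG G

/-- The point at which the polynomial is evaluated. -/
def evalPoint (I : Input) (r : List Bool) (x : Fin (m + 1)) (w : Fin n) : ZMod (I.primePred + 1) :=
  I.point r x w

/-- The table contains the values of all arcs up to depth `d`. -/
def IsValueTable (I : Input) (r : List Bool) (H : SimpleGraph (Fin m)) (G : SimpleGraph (Fin n))
    (t d : ℕ) (T : ArcTable) : Prop :=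
  ∀ (a x : Fin (m + 1)) (v w : Fin n), (T.entry a x v w : ZMod (I.primePred + 1)) =
    arcValue G (withIsolated H) (I.evalPoint r)
      (fun x w => rootValue (Fin.last m) (I.matH.compIndex ·) (I.evalPoint r) x w t) d a x v w

/-- The least vertices of the components of the host. -/
def reps (I : Input) (n : ℕ) : Finset (Fin n) := Finset.univ.filter fun w => I.matG.IsRep w

namespace RepresentsPair

variable (hI : I.RepresentsPair H G)
include hI

theorem h_eq : I.h = m := hI.pattern.length

theorem g_eq : I.g = n := hI.host.length

theorem succH_iff {a x y : Fin (m + 1)} :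
    I.SuccH a x y ↔ (withIsolated H).Adj x y ∧ y ≠ a := by
  rw [SuccH, hI.pattern.withIsolated_adj_iff, Ne, Ne, Fin.ext_iff]

theorem succG_iff {v w i : Fin n} : I.SuccG v w i ↔ G.Adj w i ∧ i ≠ v := by
  rw [SuccG, hI.host.adj_iff, Ne, Ne, Fin.ext_iff]

theorem natCast_rootPoint (x : Fin (m + 1)) (w : Fin n) :
    (I.rootPoint r t x w : ZMod (I.primePred + 1)) =
      rootValue (Fin.last m) (I.matH.compIndex ·) (I.evalPoint r) x w t := by
  simp only [rootPoint, rootValue, evalPoint, Fin.ext_iff, Fin.val_last, hI.h_eq, Nat.cast_ite,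
    Nat.cast_zero]

theorem natCast_freeValue (hT : I.IsValueTable r H G t d T) (v w : Fin n) :
    (I.freeValue r t T v w : ZMod (I.primePred + 1)) =
      branchValue G (withIsolated H) (I.evalPoint r)
        (fun x w => rootValue (Fin.last m) (I.matH.compIndex ·) (I.evalPoint r) x w t) d v w := by
  rw [freeValue, ZMod.natCast_mod, hI.h_eq, Nat.cast_sum, Finset.sum_range, branchValue]
  refine Finset.sum_congr rfl fun x _ => ?_
  rw [Nat.cast_mul, hT, hI.natCast_rootPoint]

theorem natCast_matchEntry (hT : I.IsValueTable r H G t d T) (a x : Fin (m + 1)) (v w : Fin n)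
    (i j : Fin n ⊕ Fin (m + 1)) :
    (I.matchEntry r t T a x v w (finSumFinEquiv i : Fin (n + (m + 1)))
        (finSumFinEquiv j : Fin (n + (m + 1))) : ZMod (I.primePred + 1)) =
      matchMatrix G (withIsolated H) (I.evalPoint r)
        (arcValue G (withIsolated H) (I.evalPoint r)
          (fun x w => rootValue (Fin.last m) (I.matH.compIndex ·) (I.evalPoint r) x w t) d)
        (branchValue G (withIsolated H) (I.evalPoint r)
          (fun x w => rootValue (Fin.last m) (I.matH.compIndex ·) (I.evalPoint r) x w t) d)
        a x v w i j := by
  classical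
  have not_lt (k : ℕ) : ¬n + k < n := by lia
  rcases i with i | i <;> rcases j with j | j <;>
    simp only [finSumFinEquiv_apply_left, finSumFinEquiv_apply_right, Fin.val_castAdd,
      Fin.val_natAdd] <;>
    simp only [matchEntry, matchMatrix, Matrix.of_apply, hI.g_eq, Fin.is_lt, not_lt, if_true,
      if_false, Nat.add_sub_cancel_left, Nat.add_left_cancel_iff, ← Fin.ext_iff, hI.succG_iff,
      hI.succH_iff, Nat.cast_ite, Nat.cast_zero, Nat.cast_one, Nat.cast_mul,
      hI.natCast_freeValue hT, hT _ _ _ _, evalPoint] <;>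
    split_ifs <;> rfl

open Classical in
theorem isValueTable_tableStep (hT : I.IsValueTable r H G t d T) :
    I.IsValueTable r H G t (d + 1) (I.tableStep r t T) := by
  intro a x v w
  rw [tableStep, ArcTable.entry, hI.h_eq, hI.g_eq, getD_map_range _ _ a.2, getD_map_range _ _ x.2,
    NatMat.entry_ofFn _ v.2 w.2, ← Nat.add_assoc, NatMat.natCast_detMod, arcValue_succ,
    ← Matrix.det_submatrix_equiv_self (finSumFinEquiv : Fin n ⊕ Fin (m + 1) ≃ Fin (n + m + 1))]
  congr 1
  ext i j
  rw [Matrix.submatrix_apply, NatMat.toZMod, Matrix.of_apply,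
    NatMat.entry_ofFn _ (Fin.is_lt _) (Fin.is_lt _)]
  exact hI.natCast_matchEntry hT a x v w i j

theorem isValueTable_iterate (t d : ℕ) :
    I.IsValueTable r H G t d ((I.tableStep r t)^[d] []) := by
  induction d with
  | zero => simp [IsValueTable, ArcTable.entry, NatMat.entry, arcValue]
  | succ d ih =>
    rw [Function.iterate_succ_apply']
    exact hI.isValueTable_tableStep ih

theorem natCast_total (t : ℕ) :
    (I.total r t : ZMod (I.primePred + 1)) = ∏ w ∈ I.reps n,
      branchValue G (withIsolated H) (I.evalPoint r)
        (fun x w => rootValue (Fin.last m) (I.matH.compIndex ·) (I.evalPoint r) x w t)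
        (Fintype.card (Fin n)) w w := by
  rw [total, ZMod.natCast_mod, hI.g_eq, Finset.prod_range, Nat.cast_prod, reps, Finset.prod_filter]
  refine Finset.prod_congr rfl fun w _ => ?_
  rw [valueTable, hI.g_eq, Fintype.card_fin, Nat.cast_ite, Nat.cast_one,
    hI.natCast_freeValue (hI.isValueTable_iterate t n)]

omit hI in
theorem natCast_sign (t : ℕ) :
    (I.sign t : ZMod (I.primePred + 1)) = setSign _ I.matH.compCount t := by
  rw [sign, ZMod.natCast_mod, Nat.cast_prod, setSign]
  simp only [Nat.cast_ite, Nat.cast_one, NatMat.natCast_pred]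

theorem natCast_result : (I.result r : ZMod (I.primePred + 1)) =
    altSum G (withIsolated H) (Fin.last m) (I.matH.compIndex ·) I.matH.compCount (I.reps n)
      (I.evalPoint r) := by
  rw [result, ZMod.natCast_mod, Nat.cast_sum, altSum, sets]
  refine Finset.sum_congr rfl fun t _ => ?_
  rw [Nat.cast_mul, natCast_sign, hI.natCast_total]

theorem result_eq_zero_iff : I.result r = 0 ↔
    altSum G (withIsolated H) (Fin.last m) (I.matH.compIndex ·) I.matH.compCount (I.reps n)
      (I.evalPoint r) = 0 := by
  rw [← hI.natCast_result, ZMod.natCast_eq_zero_iff]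
  exact ⟨fun h => h ▸ dvd_zero _,
    fun h => Nat.eq_zero_of_dvd_of_lt h (Nat.mod_lt _ (Nat.succ_pos _))⟩

end RepresentsPair

end Input

namespace Input

section Parameters

variable (I : Input)

theorem two_pow_width_le_primePred_and_prime :
    2 ^ I.width ≤ I.primePred ∧ (I.primePred + 1).Prime := by
  obtain ⟨p, hp, hlt, hle⟩ := Nat.exists_prime_lt_and_le_two_mul (2 ^ I.width) (by positivity)
  have hpred : (p - 1 + 1).Prime := by rwa [Nat.sub_add_cancel hp.one_le]
  exact ⟨(Nat.le_sub_one_of_lt hlt).trans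
      (Nat.le_findGreatest (P := fun q => (q + 1).Prime) ((Nat.sub_le ..).trans hle) hpred),
    Nat.findGreatest_spec (P := fun q => (q + 1).Prime) ((Nat.sub_le ..).trans hle) hpred⟩

theorem degBound_lt_two_pow_width : I.degBound < 2 ^ I.width := Nat.lt_size_self _

theorem natCast_injOn_Iio_two_pow_width :
    Set.InjOn (Nat.cast : ℕ → ZMod (I.primePred + 1)) (Set.Iio (2 ^ I.width)) := by
  have hlt {i : ℕ} (hi : i ∈ Set.Iio (2 ^ I.width)) : i < I.primePred + 1 :=
    hi.trans_le (I.two_pow_width_le_primePred_and_prime.1.trans (Nat.le_succ _))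
  intro i hi j hj h
  rwa [ZMod.natCast_eq_natCast_iff', Nat.mod_eq_of_lt (hlt hi), Nat.mod_eq_of_lt (hlt hj)] at h

theorem natCast_point (r : List Bool) (x w : ℕ) :
    (I.point r x w : ZMod (I.primePred + 1)) =
      (Nat.ofBits fun j : Fin I.width => r.getD ((x * I.g + w) * I.width + j) false : ℕ) := by
  rw [point, ZMod.natCast_mod, ofBits_eq_sum, Finset.sum_range, Nat.cast_sum, Nat.cast_sum]
  refine Finset.sum_congr rfl fun j _ => ?_
  rw [Nat.cast_ite, Nat.cast_ite, ZMod.natCast_mod]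

end Parameters

section TestPoly

open MvPolynomial SimpleGraph

variable {m n : ℕ} {H : SimpleGraph (Fin m)} {G : SimpleGraph (Fin n)} {I : Input} {r : List Bool}
  {K : Type*} [CommRing K]

/-- The polynomial that is tested: the alternating sum with a variable for each pair of a vertex of
the pattern, or the additional isolated vertex, and a vertex of the host. -/
noncomputable def testPoly (K : Type*) [CommRing K] (I : Input) (H : SimpleGraph (Fin m))
    (G : SimpleGraph (Fin n)) : MvPolynomial (Fin (m + 1) × Fin n) K :=
  altSum G (withIsolated H) (Fin.last m) (I.matH.compIndex ·) I.matH.compCount (I.reps n)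
    fun x w => X (x, w)

theorem eval_testPoly (ξ : Fin (m + 1) × Fin n → K) : eval ξ (I.testPoly K H G) =
    altSum G (withIsolated H) (Fin.last m) (I.matH.compIndex ·) I.matH.compCount (I.reps n)
      fun x w => ξ (x, w) := by
  simp only [testPoly, map_altSum, eval_X]

namespace RepresentsPair

variable (hI : I.RepresentsPair H G)
include hI

theorem compIndex_eq_of_adj (x y : Fin (m + 1)) (hxy : (withIsolated H).Adj x y) :
    I.matH.compIndex x = I.matH.compIndex y := by
  obtain ⟨u, v, huv, rfl, rfl⟩ := SimpleGraph.map_adj .. |>.1 hxy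
  exact hI.pattern.compIndex_eq_of_reachable huv.reachable

theorem reachable_of_compIndex_eq (x y : Fin (m + 1)) (hx : x ≠ Fin.last m) (hy : y ≠ Fin.last m)
    (h : I.matH.compIndex x = I.matH.compIndex y) : (withIsolated H).Reachable x y := by
  obtain ⟨u, rfl⟩ := Fin.exists_castSucc_eq.2 hx
  obtain ⟨v, rfl⟩ := Fin.exists_castSucc_eq.2 hy
  exact (hI.pattern.reachable_of_compIndex_eq h).map (Embedding.map Fin.castSuccEmb H).toHom

theorem compIndex_lt (x : Fin (m + 1)) (hx : x ≠ Fin.last m) :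
    I.matH.compIndex x < I.matH.compCount := by
  obtain ⟨u, rfl⟩ := Fin.exists_castSucc_eq.2 hx
  exact hI.pattern.compIndex_lt u

theorem exists_compIndex_eq (j : ℕ) (hj : j < I.matH.compCount) :
    ∃ x, x ≠ Fin.last m ∧ I.matH.compIndex x = j := by
  obtain ⟨v, hv⟩ := hI.pattern.exists_compIndex_eq hj
  exact ⟨v.castSucc, Fin.castSucc_ne_last v, hv⟩

theorem eq_of_mem_reps (w : Fin n) (hw : w ∈ I.reps n) (w' : Fin n) (hw' : w' ∈ I.reps n)
    (h : G.Reachable w w') : w = w' :=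
  hI.host.eq_of_isRep (Finset.mem_filter.1 hw).2 (Finset.mem_filter.1 hw').2 h

theorem exists_mem_reps_reachable (v : Fin n) : ∃ w ∈ I.reps n, G.Reachable w v := by
  obtain ⟨w, hw, hwv⟩ := hI.host.exists_isRep v
  exact ⟨w, Finset.mem_filter.2 ⟨Finset.mem_univ _, hw⟩, hwv⟩

theorem isContained_of_result_ne_zero (hG : G.IsAcyclic) (h : I.result r ≠ 0) : H ⊑ G := by
  rw [Ne, hI.result_eq_zero_iff, altSum] at h
  exact (isContained_induce_withIsolated H).trans <|
    isContained_of_sum_ne_zero (noReturn_of_isAcyclic hG) hI.compIndex_eq_of_adj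
      hI.reachable_of_compIndex_eq hI.compIndex_lt hI.eq_of_mem_reps h

theorem two_mul_totalDegree_testPoly_le [Nontrivial K] (hG : G.IsAcyclic) :
    2 * (I.testPoly K H G).totalDegree ≤ 2 ^ I.width := by
  have degree_le := totalDegree_altSum_le (H := withIsolated H) (o := Fin.last m)
    (c := (I.matH.compIndex ·)) (k := I.matH.compCount) (noReturn_of_isAcyclic hG) hI.eq_of_mem_reps
    (ξ := fun x w => (X (x, w) : MvPolynomial (Fin (m + 1) × Fin n) K))
    fun x w => (totalDegree_X _).le
  have lt_width := I.degBound_lt_two_pow_width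
  rw [Fintype.card_fin, Fintype.card_fin] at degree_le
  rw [degBound, hI.h_eq, hI.g_eq] at lt_width
  rw [testPoly]
  lia

theorem testPoly_ne_zero [Nontrivial K] (hG : G.IsAcyclic) (h : H ⊑ G) :
    I.testPoly K H G ≠ 0 := by
  cases n with
  | zero =>
    obtain ⟨φ⟩ := h
    obtain rfl : m = 0 := by_contra fun hm => (φ ⟨0, Nat.pos_of_ne_zero hm⟩).elim0
    have compCount_eq : I.matH.compCount = 0 := by
      rw [BoolMat.compCount, hI.pattern.length, Nat.count_zero]
    simp [testPoly, altSum, compCount_eq, setSign, Finset.eq_empty_of_isEmpty (I.reps 0)]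
  | succ n =>
    obtain ⟨η, f, hp⟩ := exists_placement h
    intro h0
    apply altSum_placePoint_ne_zero (K := K) (noReturn_of_isAcyclic hG) hp hI.compIndex_eq_of_adj
      hI.exists_compIndex_eq hI.compIndex_lt hI.exists_mem_reps_reachable
    rw [← eval_testPoly fun i => placePoint f (fun _ => (1 : K)) i.1 i.2, h0, map_zero]

theorem result_eq_zero_iff_eval_testPoly : I.result r = 0 ↔
    eval (fun i => (Nat.ofBits fun j : Fin I.width =>
      r.getD ((i.1 * n + i.2) * I.width + j) false : ZMod (I.primePred + 1)))
      (I.testPoly _ H G) = 0 := by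
  rw [hI.result_eq_zero_iff, eval_testPoly]
  simp only [← hI.g_eq, ← natCast_point]
  rfl

end RepresentsPair

end TestPoly

end Input

/-! ### The decision procedure -/

section Machine

variable {p : Prog} {x y y' : Data} {r s s' : List Bool} {t t' : ℕ}

theorem Eval.unique (h : Eval p x r y s t) (h' : Eval p x r y' s' t') : y = y' ∧ s = s' := by
  induction h generalizing y' s' t' <;> cases h' <;> grind

theorem Data.ofBool_injective : Function.Injective Data.ofBool
  | false, false, _ => rfl
  | true, true, _ => rfl

theorem Prog.Answers.unique {T T' : ℕ} {a a' : Bool} (h : p.Answers x T r a)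
    (h' : p.Answers x T' r a') : a = a' := by
  obtain ⟨_, _, _, h⟩ := h
  obtain ⟨_, _, _, h'⟩ := h'
  exact Data.ofBool_injective (h.unique h').1

theorem Prog.decidesWithFalseNegatives_of_answers {Q : Prop} {T : ℕ} {f : (Fin T → Bool) → Bool}
    (answers : ∀ r, p.Answers x T (List.ofFn r) (f r)) (sound : ∀ r, f r = true → Q)
    (complete : Q → 2 * Nat.card {r // f r = false} ≤ 2 ^ T) :
    p.DecidesWithFalseNegatives x Q T := by
  refine ⟨fun r => ⟨f r, answers r⟩, fun hQ r => ?_, fun hQ => ?_⟩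
  · simpa only [Bool.eq_false_iff.2 (mt (sound r) hQ)] using answers r
  · have answers_iff (r) : p.Answers x T (List.ofFn r) false ↔ f r = false :=
      ⟨fun h => (answers r).unique h, fun h => h ▸ answers r⟩
    rw [Prog.answerProb, div_le_div_iff₀ (by positivity) two_pos, one_mul, mul_comm]
    simp only [answers_iff]
    exact_mod_cast complete hQ

end Machine

section CoinTosses

variable {m n T : ℕ} {H : SimpleGraph (Fin m)} {G : SimpleGraph (Fin n)} {I : Input}

theorem getD_reverse_take_ofFn {L : ℕ} (hL : L ≤ T) (r : Fin T → Bool) (i : Fin L) :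
    ((List.ofFn r).take L).reverse.getD i false = r (i.rev.castLE hL) := by
  have length_eq : ((List.ofFn r).take L).length = L := by simp [hL]
  rw [List.getD_eq_getElem _ _ (by rw [List.length_reverse, length_eq]; exact i.2),
    List.getElem_reverse, List.getElem_take, List.getElem_ofFn]
  congr 1
  ext
  simp only [length_eq, Fin.val_castLE, Fin.val_rev]
  lia

open SimpleGraph in
theorem Input.RepresentsPair.two_mul_card_result_eq_zero_le (hI : I.RepresentsPair H G)
    (hG : G.IsAcyclic) (h : H ⊑ G) (hT : I.coins ≤ T) :
    2 * Nat.card {r : Fin T → Bool // I.result ((List.ofFn r).take I.coins).reverse = 0} ≤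
      2 ^ T := by
  have : Fact (I.primePred + 1).Prime := ⟨I.two_pow_width_le_primePred_and_prime.2⟩
  have coins_eq : (m + 1) * n * I.width = I.coins := by rw [Input.coins, hI.h_eq, hI.g_eq]
  let index : (Fin (m + 1) × Fin n) × Fin I.width ≃ Fin I.coins :=
    ((finProdFinEquiv.prodCongr (.refl _)).trans finProdFinEquiv).trans (finCongr coins_eq)
  let coin := (index.trans Fin.revPerm).toEmbedding.trans (Fin.castLEEmb hT)
  have coin_eq (r : Fin T → Bool) (i : Fin (m + 1) × Fin n) (j : Fin I.width) :
      ((List.ofFn r).take I.coins).reverse.getD ((i.1 * n + i.2) * I.width + j) false =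
        r (coin (i, j)) := by
    rw [show (i.1 * n + i.2) * I.width + j = (index (i, j) : ℕ) by simp [index]; ring]
    exact getD_reverse_take_ofFn hT r _
  simpa only [hI.result_eq_zero_iff_eval_testPoly, coin_eq, Fintype.card_fin] using
    two_mul_card_eval_ofBits_eq_zero_le (hI.testPoly_ne_zero hG h) coin
      (hI.two_mul_totalDegree_testPoly_le hG) I.natCast_injOn_Iio_two_pow_width

end CoinTosses

section RunningTime

theorem two_pow_le_two_mul_two_rpow_mul_logb (k : ℕ) :
    (2 : ℝ) ^ k ≤ 2 * 2 ^ (k * Real.logb 2 k) := by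
  rcases lt_or_ge k 2 with hk | hk
  · interval_cases k <;> norm_num
  · have two_le : (2 : ℝ) ≤ k := mod_cast hk
    have one_le_logb : 1 ≤ Real.logb 2 k := by
      rwa [Real.le_logb_iff_rpow_le one_lt_two (by linarith), Real.rpow_one]
    calc (2 : ℝ) ^ k = 2 ^ (k : ℝ) := (Real.rpow_natCast 2 k).symm
      _ ≤ 2 ^ (k * Real.logb 2 k) :=
        Real.rpow_le_rpow_of_exponent_le one_le_two (by nlinarith)
      _ ≤ 2 * 2 ^ (k * Real.logb 2 k) := le_mul_of_one_le_left (by positivity) one_le_two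

theorem natCast_mul_logb_two_nonneg (k : ℕ) : 0 ≤ k * Real.logb 2 k :=
  mul_nonneg k.cast_nonneg (div_nonneg (Real.log_natCast_nonneg k) (Real.log_nonneg one_le_two))

theorem exists_two_pow_mul_pow_le (a : ℕ) {b : ℕ} (hb : b ≠ 0) : ∃ d : ℕ, ∀ k n : ℕ,
    ((2 ^ k) ^ a * n ^ b : ℝ) ≤ d * 2 ^ (d * (k * Real.logb 2 k)) * n ^ d := by
  refine ⟨2 ^ a + b, fun k n => ?_⟩
  have nonneg := natCast_mul_logb_two_nonneg k
  have pow_le : (n : ℝ) ^ b ≤ n ^ (2 ^ a + b) := by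
    rcases n.eq_zero_or_pos with rfl | hn
    · simp [hb]
    · exact pow_le_pow_right₀ (mod_cast hn) (Nat.le_add_left ..)
  have le_add : (a : ℝ) ≤ (2 ^ a + b : ℕ) :=
    mod_cast a.lt_two_pow_self.le.trans (Nat.le_add_right ..)
  calc ((2 ^ k) ^ a * n ^ b : ℝ) ≤ (2 * 2 ^ (k * Real.logb 2 k)) ^ a * n ^ b := by
        gcongr
        exact two_pow_le_two_mul_two_rpow_mul_logb k
    _ = (2 ^ a : ℕ) * 2 ^ (a * (k * Real.logb 2 k)) * n ^ b := by
        rw [mul_pow, ← Real.rpow_mul_natCast zero_le_two, mul_comm (a : ℝ), Nat.cast_pow,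
          Nat.cast_ofNat]
    _ ≤ _ := by
        gcongr
        · exact Nat.le_add_right ..
        · exact one_le_two

theorem size_adjMat_le {n : ℕ} (G : SimpleGraph (Fin n)) : size (adjMat G) ≤ n * (n + 1) := by
  have size_row (f : Fin n → Bool) : size (List.ofFn f) ≤ n := by
    rw [size_list_bool, List.length_ofFn]
  rw [adjMat, List.ofFn_eq_map]
  exact (size_map_le fun _ _ => size_row _).trans_eq (by rw [List.length_finRange])

theorem two_pow_add_le_two_pow_mul_pow (k : ℕ) {n : ℕ} (hn : 2 ≤ n) :
    2 ^ k + 2 * (n * (n + 1)) + 2 ≤ 2 ^ k * n ^ 5 := by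
  have le_pow : 2 * (n * (n + 1)) + 2 ≤ n ^ 4 := by
    obtain ⟨m, rfl⟩ := Nat.exists_eq_add_of_le hn
    nlinarith [sq_nonneg m, pow_nonneg m.zero_le 3, pow_nonneg m.zero_le 4]
  have one_le : 1 ≤ 2 ^ k := Nat.one_le_two_pow
  have one_le_pow : 1 ≤ n ^ 4 := Nat.one_le_pow _ _ (by lia)
  calc 2 ^ k + 2 * (n * (n + 1)) + 2 ≤ 2 ^ k * n ^ 4 + 2 ^ k * n ^ 4 := by nlinarith
    _ = 2 ^ k * (2 * n ^ 4) := by ring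
    _ ≤ 2 ^ k * n ^ 5 := by rw [pow_succ' n 4]; gcongr

theorem size_adjMat_pair_add_two_le {m n : ℕ} (H : SimpleGraph (Fin m)) (G : SimpleGraph (Fin n)) :
    size (⟨adjMat H, adjMat G⟩ : Input) + 2 ≤ 2 ^ cc H * max 2 (m + n) ^ 5 := by
  refine le_trans ?_ (two_pow_add_le_two_pow_mul_pow (cc H) (le_max_left ..))
  have mul_le {a : ℕ} (ha : a ≤ m + n) :
      a * (a + 1) ≤ max 2 (m + n) * (max 2 (m + n) + 1) := by
    have := le_max_of_le_right (b := 2) ha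
    gcongr
  have pattern := (size_adjMat_le H).trans (mul_le (Nat.le_add_right ..))
  have host := (size_adjMat_le G).trans (mul_le (Nat.le_add_left ..))
  rw [(represents_adjMat H).cc_eq_compCount]
  change 2 ^ (adjMat H).compCount + (size (adjMat H) + size (adjMat G)) + 2 ≤ _
  lia

end RunningTime

theorem code_adjMat_pair {m n : ℕ} (H : SimpleGraph (Fin m)) (G : SimpleGraph (Fin n)) :
    code (⟨adjMat H, adjMat G⟩ : Input) = .cons (encodeGraph H) (encodeGraph G) :=
  congr_arg₂ Data.cons (code_adjMat H) (code_adjMat G)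

open SimpleGraph in
theorem exists_decidesWithFalseNegatives_isContained : ∃ (p : Prog) (c : ℕ),
    ∀ {m n : ℕ} {H : SimpleGraph (Fin m)} {G : SimpleGraph (Fin n)} {I : Input} {T : ℕ},
      I.RepresentsPair H G → G.IsAcyclic → (size I + 2) ^ c ≤ T →
        p.DecidesWithFalseNegatives (code I) (H ⊑ G) T := by
  have polyTime_result : PolyTime fun x : Input × List Bool => x.1.result x.2 :=
    .result (.fst .id) (.snd .id)
  obtain ⟨p, time, ⟨c, time_le⟩, coins_le, run⟩ :=
    PolyTime.exists_eval_toss (n := Input.coins) (.coins .id) polyTime_result.decide_ne_zero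
  refine ⟨p, c, fun {m n H G I T} hI hG hT => ?_⟩
  have time_le_T : time I ≤ T := (time_le I).trans hT
  have coins_le_T : I.coins ≤ T := (coins_le I).trans time_le_T
  refine Prog.decidesWithFalseNegatives_of_answers
    (f := fun r => decide (I.result ((List.ofFn r).take I.coins).reverse ≠ 0)) (fun r => ?_)
    (fun r hr => hI.isContained_of_result_ne_zero hG (of_decide_eq_true hr)) fun h => ?_
  · obtain ⟨t, ht, eval⟩ := run I (List.ofFn r) (by rwa [List.length_ofFn])
    exact ⟨_, t, ht.trans time_le_T, eval⟩
  · simpa only [decide_eq_false_iff_not, not_not] using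
      hI.two_mul_card_result_eq_zero_le hG h coins_le_T

theorem mainTheorem6 :
    ∃ (p : Prog) (T : ℕ → ℕ → ℕ) (c : ℕ),
      (∀ k n : ℕ, (T k n : ℝ) ≤
        (c : ℝ) * (2 : ℝ) ^ ((c : ℝ) * ((k : ℝ) * Real.logb 2 (k : ℝ))) * (n : ℝ) ^ c) ∧
      ∀ (h g : ℕ) (H : SimpleGraph (Fin h)) (G : SimpleGraph (Fin g)), G.IsAcyclic →
        p.DecidesWithFalseNegatives (Data.cons (encodeGraph H) (encodeGraph G))
          (H.IsContained G) (T (cc H) (max 2 (h + g))) := by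
  obtain ⟨p, a, decides⟩ := exists_decidesWithFalseNegatives_isContained
  obtain ⟨c, time_le⟩ := exists_two_pow_mul_pow_le a (b := 5 * a + 1) (Nat.succ_ne_zero _)
  refine ⟨p, fun k n => (2 ^ k) ^ a * n ^ (5 * a + 1), c, fun k n => mod_cast time_le k n,
    fun h g H G hG => ?_⟩
  rw [← code_adjMat_pair]
  refine decides ⟨represents_adjMat H, represents_adjMat G⟩ hG ?_
  set n := max 2 (h + g)
  calc (size (⟨adjMat H, adjMat G⟩ : Input) + 2) ^ a ≤ (2 ^ cc H * n ^ 5) ^ a :=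
        Nat.pow_le_pow_left (size_adjMat_pair_add_two_le H G) a
    _ = (2 ^ cc H) ^ a * n ^ (5 * a) := by rw [mul_pow, ← pow_mul _ 5]
    _ ≤ (2 ^ cc H) ^ a * n ^ (5 * a + 1) := by gcongr <;> lia
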